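/- Let $k\in\mathbb{N}$. An $\mathcal{L}'(k)$-tree is a rooted strict binary tree (every vertex is a leaf or has exactly two children; a single vertex is allowed) in which, at every internal vertex, the two edges leading to its children are assigned positive integer lengths whose sum is $k$. The depth of a leaf is the total length of the edges on the path from the root to it. A leaf signature is a multiset $D=\{d_1,\dots,d_n\}$ of $n\ge 1$ non-negative integers; it is realizable (for $k$) if there is an $\mathcal{L}'(k)$-tree with exactly $n$ leaves that can be numbered $v_1,\dots,v_n$ such that the depth of $v_i$ is at most $d_i$ for all $i$. There is an algorithm that, given $k\in\mathbb{N}$ and a leaf signature $D=\{d_1,\dots,d_n\}$ (as a list in arbitrary order), decides whether $D$ is realizable for $k$ and, if it is, constructs an $\mathcal{L}'(k)$-tree with $n$ leaves at depths at most $d_1,\dots,d_n$; for every fixed $k$ its running time is $O(n^{k+3})$, where the constant depends only on $k$. Here running time is the number of steps on a random access machine on natural numbers with unit-cost addition, truncated subtraction, zero test, and indirect memory access. -/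

import Mathlib

/-- Rooted strict binary trees with edge lengths: a single leaf, or a root with exactly two
children, where `a` and `b` are the lengths of the edges to the roots of `l` and `r`. -/
inductive LTree where
  | leaf : LTree
  | node (a b : ℕ) (l r : LTree) : LTree

namespace LTree

/-- `T.IsL k`: at every internal node the two child edges have positive lengths with sum `k`. -/
def IsL (k : ℕ) : LTree → Prop
  | leaf => True
  | node a b l r => 1 ≤ a ∧ 1 ≤ b ∧ a + b = k ∧ l.IsL k ∧ r.IsL k

/-- The multiset of the depths of the leaves, with respect to the edge lengths. -/
def leafDepths : LTree → Multiset ℕ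
  | leaf => {0}
  | node a b l r => l.leafDepths.map (a + ·) + r.leafDepths.map (b + ·)

/-- The leaves can be matched bijectively with the elements of `D` so that the depth of every leaf
is at most the element matched with it. -/
def Meets (T : LTree) (D : Multiset ℕ) : Prop :=
  Multiset.Rel (· ≤ ·) T.leafDepths D

end LTree

/-- The leaf signature `D` is realizable for the parameter `k`. -/
def Realizable (k : ℕ) (D : Multiset ℕ) : Prop :=
  ∃ T : LTree, T.IsL k ∧ T.Meets D

namespace RAM

/-- A configuration of the random access machine: registers and memory, holding natural numbers.
A program mentions only finitely many registers. -/
structure State where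
  reg : ℕ → ℕ
  mem : ℕ → ℕ

namespace State

/-- Write `v` to register `x`. -/
def setReg (s : State) (x v : ℕ) : State :=
  { s with reg := Function.update s.reg x v }

/-- Write `v` to the memory cell with address `p`. -/
def setMem (s : State) (p v : ℕ) : State :=
  { s with mem := Function.update s.mem p v }

end State

/-- Programs of the random access machine. Its arithmetic is addition and truncated subtraction
only; memory is accessed by indirect addressing. -/
inductive Prog where
  | skip : Prog
  /-- `x := c` -/
  | const (x c : ℕ) : Prog
  /-- `x := y` -/
  | copy (x y : ℕ) : Prog
  /-- `x := y + z` -/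
  | add (x y z : ℕ) : Prog
  /-- `x := y - z`, truncated at zero -/
  | sub (x y z : ℕ) : Prog
  /-- `x := mem[y]` -/
  | load (x y : ℕ) : Prog
  /-- `mem[x] := y` -/
  | store (x y : ℕ) : Prog
  | seq (P Q : Prog) : Prog
  /-- run `P` if register `x` is nonzero, and `Q` otherwise -/
  | branch (x : ℕ) (P Q : Prog) : Prog
  /-- run `P` as long as register `x` is nonzero -/
  | loop (x : ℕ) (P : Prog) : Prog

/-- `Exec P s t s'`: the program `P`, started in `s`, halts in `s'` after exactly `t` steps. Every
elementary instruction and every evaluation of the test of a branch or of a loop is one step. -/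
inductive Exec : Prog → State → ℕ → State → Prop where
  | skip (s : State) : Exec .skip s 1 s
  | const (s : State) (x c : ℕ) : Exec (.const x c) s 1 (s.setReg x c)
  | copy (s : State) (x y : ℕ) : Exec (.copy x y) s 1 (s.setReg x (s.reg y))
  | add (s : State) (x y z : ℕ) : Exec (.add x y z) s 1 (s.setReg x (s.reg y + s.reg z))
  | sub (s : State) (x y z : ℕ) : Exec (.sub x y z) s 1 (s.setReg x (s.reg y - s.reg z))
  | load (s : State) (x y : ℕ) : Exec (.load x y) s 1 (s.setReg x (s.mem (s.reg y)))
  | store (s : State) (x y : ℕ) : Exec (.store x y) s 1 (s.setMem (s.reg x) (s.reg y))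
  | seq {P Q : Prog} {s s₁ s₂ : State} {t₁ t₂ : ℕ} (hP : Exec P s t₁ s₁) (hQ : Exec Q s₁ t₂ s₂) :
      Exec (.seq P Q) s (t₁ + t₂) s₂
  | branch_ne {x : ℕ} {P Q : Prog} {s s₁ : State} {t : ℕ} (hx : s.reg x ≠ 0) (hP : Exec P s t s₁) :
      Exec (.branch x P Q) s (1 + t) s₁
  | branch_eq {x : ℕ} {P Q : Prog} {s s₁ : State} {t : ℕ} (hx : s.reg x = 0) (hQ : Exec Q s t s₁) :
      Exec (.branch x P Q) s (1 + t) s₁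
  | loop_ne {x : ℕ} {P : Prog} {s s₁ s₂ : State} {t₁ t₂ : ℕ} (hx : s.reg x ≠ 0)
      (hP : Exec P s t₁ s₁) (hL : Exec (.loop x P) s₁ t₂ s₂) :
      Exec (.loop x P) s (1 + t₁ + t₂) s₂
  | loop_eq {x : ℕ} {P : Prog} {s : State} (hx : s.reg x = 0) : Exec (.loop x P) s 1 s

/-- The initial configuration for the parameter `k` and the signature `d₁, …, dₙ`, listed in any
order: register 0 holds `n`, register 1 holds `k`, the memory cells `0, …, n - 1` hold
`d₁, …, dₙ`, and everything else is zero. -/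
def input (k : ℕ) (d : List ℕ) : State where
  reg x := if x = 0 then d.length else if x = 1 then k else 0
  mem p := d.getD p 0

/-- `Stored m T p S`: the tree `T` is stored in the memory `m` as a linked structure with root
record at address `p`, the records occupying exactly the cells in `S` and not overlapping. A leaf
is a cell with content 0. An internal node consists of four consecutive cells with the lengths of
its two child edges, the first of which is nonzero, and the addresses of its two children. -/
inductive Stored (m : ℕ → ℕ) : LTree → ℕ → Finset ℕ → Prop where
  | leaf {p : ℕ} (hp : m p = 0) : Stored m .leaf p {p}
  | node {p : ℕ} {l r : LTree} {S₁ S₂ : Finset ℕ} (hp : m p ≠ 0)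
      (hl : Stored m l (m (p + 2)) S₁) (hr : Stored m r (m (p + 3)) S₂)
      (h₁₂ : Disjoint S₁ S₂) (h₁ : Disjoint {p, p + 1, p + 2, p + 3} S₁)
      (h₂ : Disjoint {p, p + 1, p + 2, p + 3} S₂) :
      Stored m (.node (m p) (m (p + 1)) l r) p ({p, p + 1, p + 2, p + 3} ∪ S₁ ∪ S₂)

end RAM

/-! Build the tree from the root downwards, level by level. A configuration consists of the current
level, the number of finished leaves, and the multiset of the levels of the pending vertices, which
are those whose parents have been processed. By Hall's condition for thresholds, a leaf at level `l`
is admissible if and only if at least as many leaves are already finished as there are `d_i < l`;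
hence the finished leaves only have to be counted, and `D` is realizable if and only if a
configuration with `n` finished leaves can be reached.

The pending levels lie between the current level and the one `K = k - 1` below it, so a pending
multiset is given by `K + 1` occurrence counts, at most `n` each. As the level is at most `K * n`,
every configuration with at most `n` vertices can be numbered by a number less than
`(n + 1) ^ (K + 2) * (K * n + 1) = O(n ^ (k + 2))`, and the numbering can be chosen in such a way
that all steps decrease the number. A single sweep over a table of the configurations, by decreasing
number, therefore finds all that are reachable. The work per configuration is `O(n + k)`, and
following the links to the previous configurations back from the final one builds the tree. -/

/-! The registers below `rTest` hold the number `n` of leaves (at the end: the answer), `k` (at the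
end: the address of the tree), the constants `1` and `K = k - 1`, the base `n + 1` of the numbering
of the configurations, `8 * (n + 1) ^ e` for `e = K, K + 1, K + 2`, the first address of the table
and the first one after it, the size `8` of a record, the address of the final record that has been
found, the offset of the sweep, and the address and the contents of the current record. -/

local notation "rN" => 0
local notation "rK" => 1
local notation "rOne" => 2
local notation "rDelta" => 3
local notation "rBase" => 4
local notation "rPow" => 5
local notation "rRow" => 6
local notation "rLayer" => 7
local notation "rTable" => 8
local notation "rEnd" => 9
local notation "rEight" => 10
local notation "rGoal" => 11
local notation "rSweep" => 12
local notation "rAddr" => 13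
local notation "rCount" => 14
local notation "rLev" => 15
local notation "rDone" => 16
local notation "rCode" => 17
local notation "rTest" => 18
local notation "rNewAddr" => 19
local notation "rNewCount" => 20
local notation "rNewLev" => 21
local notation "rNewDone" => 22
local notation "rNewCode" => 23
local notation "rNewMove" => 24
local notation "rPtr" => 25
local notation "rTmp" => 26
local notation "rIter" => 27
local notation "rAcc" => 28
local notation "rSlot" => 29
local notation "rNode" => 30
local notation "rRight" => 31
local notation "rFree" => 32
local notation "rMove" => 33

/-! ### Correctness and running time of programs -/

namespace RAM

namespace State

@[simp]
theorem reg_setReg (s : State) (x v y : ℕ) :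
    (s.setReg x v).reg y = if y = x then v else s.reg y := by
  simp [setReg, Function.update_apply]

@[simp]
theorem mem_setReg (s : State) (x v : ℕ) : (s.setReg x v).mem = s.mem := rfl

@[simp]
theorem reg_setMem (s : State) (p v : ℕ) : (s.setMem p v).reg = s.reg := rfl

@[simp]
theorem mem_setMem (s : State) (p v : ℕ) : (s.setMem p v).mem = Function.update s.mem p v := rfl

end State

namespace Prog

/-- Sequential composition of a list of programs. -/
def block : List Prog → Prog
  | [] => skip
  | P :: l => seq P (block l)

/-- The program contains no loop, so that it can be executed symbolically by `Prog.run`. -/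
def loopFree : Prog → Bool
  | seq P Q => P.loopFree && Q.loopFree
  | branch _ P Q => P.loopFree && Q.loopFree
  | loop _ _ => false
  | _ => true

/-- The final state of a loop-free program; loops are ignored. -/
def run : Prog → State → State
  | skip, s => s
  | const x c, s => s.setReg x c
  | copy x y, s => s.setReg x (s.reg y)
  | add x y z, s => s.setReg x (s.reg y + s.reg z)
  | sub x y z, s => s.setReg x (s.reg y - s.reg z)
  | load x y, s => s.setReg x (s.mem (s.reg y))
  | store x y, s => s.setMem (s.reg x) (s.reg y)
  | seq P Q, s => Q.run (P.run s)
  | branch x P Q, s => if s.reg x = 0 then Q.run s else P.run s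
  | loop _ _, s => s

attribute [simp] block run

/-- An upper bound for the number of steps of a loop-free program. -/
def cost : Prog → ℕ
  | seq P Q => P.cost + Q.cost
  | branch _ P Q => 1 + max P.cost Q.cost
  | _ => 1

/-- The registers that occur as the target of an instruction of the program. -/
def targets : Prog → List ℕ
  | const x _ | copy x _ | add x _ _ | sub x _ _ | load x _ => [x]
  | seq P Q | branch _ P Q => P.targets ++ Q.targets
  | loop _ P => P.targets
  | skip | store _ _ => []

/-- The program never writes to the memory. -/
def storeFree : Prog → Bool
  | store _ _ => false
  | seq P Q | branch _ P Q => P.storeFree && Q.storeFree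
  | loop _ P => P.storeFree
  | _ => true

end Prog

theorem Exec.reg_eq_of_notMem_targets {P : Prog} {s s' : State} {t : ℕ} (h : Exec P s t s')
    {r : ℕ} (hr : r ∉ P.targets) : s'.reg r = s.reg r := by
  induction h with
  | seq _ _ h₁ h₂ => grind [Prog.targets]
  | branch_ne _ _ h => grind [Prog.targets]
  | branch_eq _ _ h => grind [Prog.targets]
  | loop_ne _ _ _ h₁ h₂ => grind [Prog.targets]
  | skip | loop_eq | store => rfl
  | _ => simp_all [Prog.targets]

theorem Exec.mem_eq_of_storeFree {P : Prog} {s s' : State} {t : ℕ} (h : Exec P s t s')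
    (hP : P.storeFree = true) : s'.mem = s.mem := by
  induction h with
  | seq _ _ h₁ h₂ => simp_all [Prog.storeFree]
  | branch_ne _ _ h | branch_eq _ _ h => simp_all [Prog.storeFree]
  | loop_ne _ _ _ h₁ h₂ => simp_all [Prog.storeFree]
  | store => simp [Prog.storeFree] at hP
  | _ => rfl

theorem Prog.exists_exec_run :
    ∀ {P : Prog}, P.loopFree = true → ∀ s, ∃ t ≤ P.cost, Exec P s t (P.run s) := by
  intro P
  induction P with
  | seq P Q hP hQ =>
    intro h s
    simp only [loopFree, Bool.and_eq_true] at h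
    obtain ⟨t, ht, hexec⟩ := hP h.1 s
    obtain ⟨t', ht', hexec'⟩ := hQ h.2 (P.run s)
    exact ⟨_, add_le_add ht ht', hexec.seq hexec'⟩
  | branch x P Q hP hQ =>
    intro h s
    simp only [loopFree, Bool.and_eq_true] at h
    obtain ⟨t, ht, hexec⟩ := hP h.1 s
    obtain ⟨t', ht', hexec'⟩ := hQ h.2 s
    by_cases hx : s.reg x = 0
    · exact ⟨1 + t', by simp only [cost]; omega, by simpa [run, hx] using .branch_eq hx hexec'⟩
    · exact ⟨1 + t, by simp only [cost]; omega, by simpa [run, hx] using .branch_ne hx hexec⟩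
  | loop => simp [loopFree]
  | _ => exact fun _ s => ⟨1, le_rfl, by constructor⟩

theorem Prog.reg_run_of_notMem_targets {P : Prog} (hP : P.loopFree = true) {r : ℕ}
    (hr : r ∉ P.targets) (s : State) : (P.run s).reg r = s.reg r :=
  let ⟨_, _, hexec⟩ := exists_exec_run hP s
  hexec.reg_eq_of_notMem_targets hr

theorem Prog.mem_run_of_storeFree {P : Prog} (hP : P.loopFree = true) (hst : P.storeFree = true)
    (s : State) : (P.run s).mem = s.mem :=
  let ⟨_, _, hexec⟩ := exists_exec_run hP s
  hexec.mem_eq_of_storeFree hst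

/-- Total correctness with a time bound: started in `s`, the program `P` halts after at most `T`
steps in a state that satisfies `Q`. -/
def HaltsWithin (P : Prog) (s : State) (T : ℕ) (Q : State → Prop) : Prop :=
  ∃ t s', Exec P s t s' ∧ t ≤ T ∧ Q s'

namespace HaltsWithin

variable {P P' : Prog} {s : State} {T T' : ℕ} {Q R : State → Prop}

theorem of_le (h : HaltsWithin P s T Q) (hT : T ≤ T') : HaltsWithin P s T' Q := by
  obtain ⟨t, s', hexec, ht, hQ⟩ := h
  exact ⟨t, s', hexec, ht.trans hT, hQ⟩

theorem imp (h : HaltsWithin P s T Q) (hQ : ∀ s', Q s' → R s') : HaltsWithin P s T R := by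
  obtain ⟨t, s', hexec, ht, h⟩ := h
  exact ⟨t, s', hexec, ht, hQ _ h⟩

theorem seq (h : HaltsWithin P s T Q) (h' : ∀ s', Q s' → HaltsWithin P' s' T' R) :
    HaltsWithin (.seq P P') s (T + T') R := by
  obtain ⟨t, s', hexec, ht, hQ⟩ := h
  obtain ⟨t', s'', hexec', ht', hR⟩ := h' s' hQ
  exact ⟨_, _, hexec.seq hexec', add_le_add ht ht', hR⟩

theorem branch {x : ℕ} (h : s.reg x ≠ 0 → HaltsWithin P s T Q)
    (h' : s.reg x = 0 → HaltsWithin P' s T Q) : HaltsWithin (.branch x P P') s (1 + T) Q := by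
  by_cases hx : s.reg x = 0
  · obtain ⟨t, s', hexec, ht, hQ⟩ := h' hx
    exact ⟨_, _, .branch_eq hx hexec, by omega, hQ⟩
  · obtain ⟨t, s', hexec, ht, hQ⟩ := h hx
    exact ⟨_, _, .branch_ne hx hexec, by omega, hQ⟩

/-- The invariant `I j` holds when `j` iterations are left. -/
theorem loop {x : ℕ} {I : ℕ → State → Prop} (hzero : ∀ s, I 0 s → s.reg x = 0)
    (hsucc : ∀ j s, I (j + 1) s → s.reg x ≠ 0 ∧ HaltsWithin P s T (I j)) :
    ∀ j s, I j s → HaltsWithin (.loop x P) s (j * (T + 1) + 1) (I 0) := by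
  intro j
  induction j with
  | zero => exact fun s h => ⟨1, s, .loop_eq (hzero s h), by simp, h⟩
  | succ j ih =>
    intro s h
    obtain ⟨hx, t, s', hexec, ht, hI⟩ := hsucc j s h
    obtain ⟨t', s'', hexec', ht', hI'⟩ := ih s' hI
    exact ⟨_, _, .loop_ne hx hexec hexec', by rw [Nat.succ_mul]; omega, hI'⟩

theorem of_loopFree (hP : P.loopFree = true) (h : Q (P.run s)) : HaltsWithin P s P.cost Q := by
  obtain ⟨t, ht, hexec⟩ := Prog.exists_exec_run hP s
  exact ⟨t, _, hexec, ht, h⟩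

theorem and_reg_eq (h : HaltsWithin P s T Q) :
    HaltsWithin P s T fun s' => Q s' ∧ ∀ r, r ∉ P.targets → s'.reg r = s.reg r := by
  obtain ⟨t, s', hexec, ht, hQ⟩ := h
  exact ⟨t, s', hexec, ht, hQ, fun r hr => hexec.reg_eq_of_notMem_targets hr⟩

theorem and_mem_eq (h : HaltsWithin P s T Q) (hP : P.storeFree = true) :
    HaltsWithin P s T fun s' => Q s' ∧ s'.mem = s.mem := by
  obtain ⟨t, s', hexec, ht, hQ⟩ := h
  exact ⟨t, s', hexec, ht, hQ, hexec.mem_eq_of_storeFree hP⟩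

end HaltsWithin

/-- Multiply by repeated addition: `x := y * z`, with `w` as the counter. -/
def Prog.mul (x y z w : ℕ) : Prog :=
  .seq (.seq (.copy w z) (.const x 0)) (.loop w (.seq (.add x x y) (.sub w w rOne)))

theorem haltsWithin_mul {s : State} {x y z w a b : ℕ} (hone : s.reg rOne = 1)
    (hy : s.reg y = a) (hz : s.reg z = b) (hnd : [x, y, w, rOne].Nodup) :
    HaltsWithin (.mul x y z w) s (3 * b + 3) fun s' => s'.reg x = a * b := by
  subst hy hz
  have key : HaltsWithin (.mul x y z w) s (2 + (s.reg z * (2 + 1) + 1)) fun s' =>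
      s'.reg x + s.reg y * 0 = s.reg y * s.reg z := by
    simp only [List.nodup_cons, List.mem_cons, not_or] at hnd
    obtain ⟨⟨hxy, hxw, hx, -⟩, ⟨hyw, -⟩, ⟨hw, -⟩, -⟩ := hnd
    refine (HaltsWithin.of_loopFree (Q := (· = (s.setReg w (s.reg z)).setReg x 0)) rfl rfl).seq ?_
    rintro _ rfl
    refine (HaltsWithin.loop (I := fun j s' => s'.reg w = j ∧ s'.reg y = s.reg y ∧
      s'.reg rOne = 1 ∧ s'.reg x + s.reg y * j = s.reg y * s.reg z) (fun _ h => h.1) ?_ _ _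
        ?_).imp fun _ h => h.2.2.2
    · rintro j s' ⟨hj, hsy, hs, hsum⟩
      refine ⟨by omega, .of_loopFree rfl ?_⟩
      simp [hj, hsy, hs, ← hsum, Ne.symm hxw, Ne.symm hxy, Ne.symm hx, Ne.symm hw, hxw, hyw,
        mul_add]
      ring
    · simp [Ne.symm hxw, Ne.symm hxy, Ne.symm hx, Ne.symm hw, hyw, hone]
  exact (key.of_le (by omega)).imp fun s' h => by simpa using h

end RAM

/-! ### Realizability as reachability of a final configuration -/

section Matching

variable {α : Type*} [LinearOrder α] {X D : Multiset α}

theorem countP_lt_le_of_rel_le (h : Multiset.Rel (· ≤ ·) X D) (l : α) :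
    D.countP (· < l) ≤ X.countP (· < l) := by
  induction h with
  | zero => simp
  | cons hab _ ih =>
    simp only [Multiset.countP_cons]
    split_ifs with hb ha
    · omega
    · exact absurd (hab.trans_lt hb) ha
    · omega
    · omega

theorem exists_eq_cons_forall_le (hX : X ≠ 0) : ∃ a Y, X = a ::ₘ Y ∧ ∀ y ∈ Y, a ≤ y := by
  obtain ⟨a, ha, hmin⟩ := X.toFinset.exists_min_image id (Multiset.toFinset_nonempty.2 hX)
  obtain ⟨Y, rfl⟩ := Multiset.exists_cons_of_mem (Multiset.mem_toFinset.1 ha)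
  exact ⟨a, Y, rfl, fun y hy => hmin y (by simp [hy])⟩

/-- A form of Hall's condition: it suffices to match the smallest elements with each other. -/
theorem rel_le_of_countP_lt_le (hcard : X.card = D.card)
    (h : ∀ l, D.countP (· < l) ≤ X.countP (· < l)) : Multiset.Rel (· ≤ ·) X D := by
  induction hm : D.card generalizing X D with
  | zero =>
    obtain rfl := Multiset.card_eq_zero.1 hm
    obtain rfl := Multiset.card_eq_zero.1 hcard
    exact .zero
  | succ m ih =>
    obtain ⟨b, D, rfl, hb⟩ := exists_eq_cons_forall_le (X := D) (by rintro rfl; simp at hm)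
    obtain ⟨a, X, rfl, ha⟩ := exists_eq_cons_forall_le (X := X) (by rintro rfl; simp at hcard)
    have hab : a ≤ b := by
      by_contra! hba
      have hX : (a ::ₘ X).countP (· < a) = 0 :=
        Multiset.countP_eq_zero.2 (by simpa using ha)
      have hD : 0 < (b ::ₘ D).countP (· < a) := Multiset.countP_pos.2 ⟨b, by simp, hba⟩
      exact absurd (h a) (by omega)
    refine .cons hab (ih (by simpa using hcard) (fun l => ?_) (by simpa using hm))
    by_cases hbl : b < l
    · simpa [hbl, hab.trans_lt hbl] using h l
    · have hD : D.countP (· < l) = 0 :=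
        Multiset.countP_eq_zero.2 fun y hy hyl => hbl ((hb y hy).trans_lt hyl)
      omega

end Matching

namespace LTree

/-- The number of vertices; processing a pending vertex decreases the total size of the forest that
is still to be built. -/
def size : LTree → ℕ
  | leaf => 1
  | node _ _ l r => l.size + r.size + 1

theorem isL_pred_add_one {k : ℕ} (T : LTree) : T.IsL (k - 1 + 1) ↔ T.IsL k := by
  induction T with
  | leaf => rfl
  | node a b l r hl hr =>
    rw [IsL, IsL, hl, hr]
    exact ⟨fun ⟨ha, hb, _, h⟩ => ⟨ha, hb, by omega, h⟩,
      fun ⟨ha, hb, _, h⟩ => ⟨ha, hb, by omega, h⟩⟩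

theorem card_leafDepths_pos (T : LTree) : 0 < T.leafDepths.card := by
  induction T with
  | leaf => simp [leafDepths]
  | node a b l r hl hr => simp only [leafDepths, Multiset.card_add, Multiset.card_map]; omega

/-- The multiset of the depths of the leaves of a forest, each of whose trees comes with the depth
of its root. -/
def forestDepths (F : Multiset (ℕ × LTree)) : Multiset ℕ :=
  F.bind fun x => x.2.leafDepths.map (x.1 + ·)

variable {F : Multiset (ℕ × LTree)} {l a b x : ℕ} {T T' : LTree}

@[simp]
theorem forestDepths_zero : forestDepths 0 = 0 := Multiset.zero_bind _

theorem forestDepths_cons :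
    forestDepths ((l, T) ::ₘ F) = T.leafDepths.map (l + ·) + forestDepths F :=
  Multiset.cons_bind _ _ _

@[simp]
theorem forestDepths_cons_leaf :
    forestDepths ((l, leaf) ::ₘ F) = l ::ₘ forestDepths F := by
  simp [forestDepths_cons, leafDepths]

@[simp]
theorem forestDepths_cons_node :
    forestDepths ((l, node a b T T') ::ₘ F) =
      forestDepths ((l + a, T) ::ₘ (l + b, T') ::ₘ F) := by
  simp [forestDepths_cons, leafDepths, Multiset.map_map, add_assoc]

@[simp]
theorem forestDepths_singleton_zero : forestDepths {(0, T)} = T.leafDepths := by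
  simp [forestDepths]

theorem card_le_card_forestDepths (F : Multiset (ℕ × LTree)) :
    F.card ≤ (forestDepths F).card := by
  induction F using Multiset.induction with
  | empty => simp
  | cons x F ih =>
    have := x.2.card_leafDepths_pos
    rw [forestDepths_cons, Multiset.card_add, Multiset.card_map, Multiset.card_cons]
    omega

theorem le_of_mem_forestDepths (hF : ∀ y ∈ F, l ≤ y.1) (hx : x ∈ forestDepths F) : l ≤ x := by
  simp only [forestDepths, Multiset.mem_bind, Multiset.mem_map] at hx
  obtain ⟨y, hy, z, -, rfl⟩ := hx
  exact (hF y hy).trans (Nat.le_add_right _ _)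

end LTree

theorem realizable_pred_add_one {k : ℕ} {D : Multiset ℕ} :
    Realizable (k - 1 + 1) D ↔ Realizable k D := by
  simp only [Realizable, LTree.isL_pred_add_one]

/-- A configuration of the construction of a tree by increasing depth: the current level, the number
of leaves that are finished, and the levels of the pending vertices, that is, of those of which it
is still to be decided whether they are leaves. -/
structure Conf where
  lev : ℕ
  done : ℕ
  pend : Multiset ℕ

namespace Conf

/-- The start configuration, in which only the root is pending. -/
def start : Conf := ⟨0, 0, {0}⟩

/-- `Step n K D mv s s'`: the configuration `s'` may follow `s` in the construction of a tree that
has at most `n` leaves and meets `D`, with edge lengths adding up to `K + 1`. The code `mv` of the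
step is `0` for the passage to the next level, `K + 1` for a leaf, and the length of the first edge
for an internal vertex. -/
inductive Step (n K : ℕ) (D : Multiset ℕ) : ℕ → Conf → Conf → Prop where
  | shift {l i : ℕ} {M : Multiset ℕ} (hl : l ∉ M) (hM : M ≠ 0) :
      Step n K D 0 ⟨l, i, M⟩ ⟨l + 1, i, M⟩
  | leaf {l i : ℕ} {M : Multiset ℕ} (hD : D.countP (· < l) ≤ i) :
      Step n K D (K + 1) ⟨l, i, l ::ₘ M⟩ ⟨l, i + 1, M⟩
  | split {a b l i : ℕ} {M : Multiset ℕ} (ha : 1 ≤ a) (hb : 1 ≤ b) (hab : a + b = K + 1)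
      (hn : i + M.card + 1 < n) :
      Step n K D a ⟨l, i, l ::ₘ M⟩ ⟨l, i, (l + a) ::ₘ (l + b) ::ₘ M⟩

/-- The constraints that are satisfied by all reachable configurations. -/
structure Valid (n K : ℕ) (s : Conf) : Prop where
  lev_le : s.lev ≤ K * n
  le_pend : ∀ x ∈ s.pend, s.lev ≤ x
  pend_le : ∀ x ∈ s.pend, x ≤ s.lev + K
  pend_add_le : ∀ x ∈ s.pend, x + K ≤ K * (s.done + s.pend.card)
  card_le : s.done + s.pend.card ≤ n
  card_pos : 0 < s.done + s.pend.card

variable {n K mv l i a b : ℕ} {D M : Multiset ℕ} {s s' : Conf}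

theorem valid_start (hn : 0 < n) : start.Valid n K := by
  constructor <;> simp [start, Nat.succ_le_of_lt hn]

theorem Valid.shift (h : Valid n K ⟨l, i, M⟩) (hl : l ∉ M) (hM : M ≠ 0) :
    Valid n K ⟨l + 1, i, M⟩ := by
  have hlt : ∀ x ∈ M, l + 1 ≤ x := fun x hx =>
    Nat.lt_of_le_of_ne (h.le_pend x hx) fun e => hl (e ▸ hx)
  obtain ⟨x, hx⟩ := Multiset.exists_mem_of_ne_zero hM
  refine { h with lev_le := ?_, le_pend := hlt, pend_le := fun y hy => ?_ }
  · calc l + 1 ≤ x + K := (hlt x hx).trans (Nat.le_add_right _ _)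
      _ ≤ K * (i + M.card) := h.pend_add_le x hx
      _ ≤ K * n := Nat.mul_le_mul_left K h.card_le
  · exact (h.pend_le y hy).trans (by simp only; omega)

theorem Valid.leaf (h : Valid n K ⟨l, i, l ::ₘ M⟩) : Valid n K ⟨l, i + 1, M⟩ := by
  have hcard : i + 1 + M.card = i + (l ::ₘ M).card := by rw [Multiset.card_cons]; omega
  exact ⟨h.lev_le, fun x hx => h.le_pend x (Multiset.mem_cons_of_mem hx),
    fun x hx => h.pend_le x (Multiset.mem_cons_of_mem hx),
    fun x hx => by simpa only [hcard] using h.pend_add_le x (Multiset.mem_cons_of_mem hx),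
    hcard.trans_le h.card_le, by simp only; omega⟩

theorem Valid.split (h : Valid n K ⟨l, i, l ::ₘ M⟩) (ha : 1 ≤ a) (hb : 1 ≤ b)
    (hab : a + b = K + 1) (hn : i + M.card + 1 < n) :
    Valid n K ⟨l, i, (l + a) ::ₘ (l + b) ::ₘ M⟩ := by
  obtain ⟨hlev, hle, hpend, hadd, -, -⟩ := h
  simp only [Multiset.mem_cons, forall_eq_or_imp, Multiset.card_cons] at hle hpend hadd
  have hmul : K * (i + (M.card + 1 + 1)) = K * (i + (M.card + 1)) + K := by ring
  constructor <;>
    simp only [Multiset.mem_cons, forall_eq_or_imp, Multiset.card_cons, hmul]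
  · exact hlev
  · exact ⟨by omega, by omega, hle.2⟩
  · exact ⟨by omega, by omega, hpend.2⟩
  · exact ⟨by omega, by omega, fun x hx => (hadd.2 x hx).trans (by omega)⟩
  · omega
  · omega

theorem Step.valid (h : Step n K D mv s s') (hs : s.Valid n K) : s'.Valid n K := by
  cases h with
  | shift hl hM => exact hs.shift hl hM
  | leaf => exact hs.leaf
  | split ha hb hab hn => exact hs.split ha hb hab hn

open LTree

/-- If the pending vertices of `s` become the roots of the trees of `F`, then a tree with `D.card`
leaves that meets `D` is obtained. The finished leaves are counted for every `x`: where this is too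
generous, the steps have already ensured that there are enough of them. -/
structure Completes (K : ℕ) (D : Multiset ℕ) (s : Conf) (F : Multiset (ℕ × LTree)) : Prop where
  map_fst : F.map Prod.fst = s.pend
  isL : ∀ x ∈ F, x.2.IsL (K + 1)
  card : s.done + (forestDepths F).card = D.card
  countP_le : ∀ x, D.countP (· < x) ≤ s.done + (forestDepths F).countP (· < x)

variable {F : Multiset (ℕ × LTree)} {T T' : LTree}

theorem completes_zero (hD : D.card = n) (l : ℕ) : Completes K D ⟨l, n, 0⟩ 0 :=
  ⟨by simp, by simp, by simp [hD],
    fun x => by simpa [hD] using Multiset.countP_le_card (· < x) D⟩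

theorem completes_start_iff :
    Completes K D start {(0, T)} ↔ T.IsL (K + 1) ∧ T.Meets D := by
  refine ⟨fun h => ⟨by simpa using h.isL, ?_⟩, fun ⟨hT, hD⟩ => ⟨by simp [start], by simpa, ?_, ?_⟩⟩
  · exact rel_le_of_countP_lt_le (by simpa [start] using h.card)
      (by simpa [start] using h.countP_le)
  · simpa [start] using Multiset.card_eq_card_of_rel hD
  · simpa [start] using countP_lt_le_of_rel_le hD

theorem Completes.exists_eq_singleton (h : Completes K D start F) : ∃ T, F = {(0, T)} := by
  obtain ⟨⟨l, T⟩, hF, rfl⟩ := Multiset.map_eq_singleton.1 h.map_fst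
  exact ⟨T, hF⟩

theorem completes_shift_iff : Completes K D ⟨l + 1, i, M⟩ F ↔ Completes K D ⟨l, i, M⟩ F :=
  ⟨fun h => ⟨h.1, h.2, h.3, h.4⟩, fun h => ⟨h.1, h.2, h.3, h.4⟩⟩

theorem Completes.leaf (h : Completes K D ⟨l, i + 1, M⟩ F) (hD : D.countP (· < l) ≤ i) :
    Completes K D ⟨l, i, l ::ₘ M⟩ ((l, .leaf) ::ₘ F) := by
  refine ⟨by simpa using h.map_fst, by simpa [IsL] using h.isL, ?_, fun x => ?_⟩
  · have hcard : i + 1 + (forestDepths F).card = D.card := h.card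
    simp only [forestDepths_cons_leaf, Multiset.card_cons]
    omega
  · have hle : D.countP (· < x) ≤ i + 1 + (forestDepths F).countP (· < x) := h.countP_le x
    simp only [forestDepths_cons_leaf, Multiset.countP_cons]
    split_ifs with hx
    · omega
    · have : D.countP (· < x) ≤ D.countP (· < l) := by
        rw [Multiset.countP_eq_card_filter, Multiset.countP_eq_card_filter]
        exact Multiset.card_le_card (Multiset.monotone_filter_right D fun y hy => by omega)
      omega

theorem Completes.of_leaf (h : Completes K D ⟨l, i, l ::ₘ M⟩ ((l, .leaf) ::ₘ F))
    (hl : ∀ x ∈ M, l ≤ x) : D.countP (· < l) ≤ i ∧ Completes K D ⟨l, i + 1, M⟩ F := by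
  obtain ⟨hfst, hL, hcard, hcount⟩ := h
  simp only [Multiset.map_cons, Multiset.cons_inj_right, Multiset.mem_cons, forall_eq_or_imp,
    forestDepths_cons_leaf, Multiset.card_cons, Multiset.countP_cons] at hfst hL hcard hcount
  have hzero : (forestDepths F).countP (· < l) = 0 := Multiset.countP_eq_zero.2 fun x hx =>
    (le_of_mem_forestDepths (fun y hy => hl _ (hfst ▸ Multiset.mem_map_of_mem _ hy)) hx).not_gt
  refine ⟨by simpa [hzero] using hcount l, hfst, hL.2, by simp only; omega, fun x => ?_⟩
  have hx := hcount x
  simp only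
  split_ifs at hx <;> omega

theorem completes_node_iff :
    Completes K D ⟨l, i, l ::ₘ M⟩ ((l, .node a b T T') ::ₘ F) ↔ 1 ≤ a ∧ 1 ≤ b ∧ a + b = K + 1 ∧
      Completes K D ⟨l, i, (l + a) ::ₘ (l + b) ::ₘ M⟩ ((l + a, T) ::ₘ (l + b, T') ::ₘ F) := by
  refine ⟨fun ⟨hfst, hL, hcard, hcount⟩ => ?_, fun ⟨ha, hb, hab, hfst, hL, hcard, hcount⟩ => ?_⟩
  · simp only [Multiset.mem_cons, forall_eq_or_imp, IsL] at hL
    obtain ⟨⟨ha, hb, hab, hT, hT'⟩, hL⟩ := hL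
    exact ⟨ha, hb, hab, by simpa using hfst,
      by simpa [hT, hT'] using fun x T h => hL (x, T) h,
      by simpa using hcard, by simpa using hcount⟩
  · simp only [Multiset.mem_cons, forall_eq_or_imp] at hL
    exact ⟨by simpa using hfst,
      by simpa [IsL, ha, hb, hab, hL.1, hL.2.1] using fun x T h => hL.2.2 (x, T) h,
      by simpa using hcard, by simpa using hcount⟩

/-- A bound for the number of steps that complete `s` with the forest `F`. -/
def stepBound (n K : ℕ) (s : Conf) (F : Multiset (ℕ × LTree)) : ℕ :=
  (F.map fun x => x.2.size).sum + (K * n - s.lev)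

theorem Completes.exists_step (h : Completes K D s F) (hD : D.card = n) (hs : s.Valid n K)
    (hF : F ≠ 0) : ∃ mv s' F', Step n K D mv s s' ∧ Completes K D s' F' ∧
      stepBound n K s' F' < stepBound n K s F := by
  obtain ⟨l, i, M⟩ := s
  by_cases hl : l ∈ M
  · have hlF : l ∈ F.map Prod.fst := by rwa [h.map_fst]
    obtain ⟨⟨l, T⟩, hx, rfl⟩ := Multiset.mem_map.1 hlF
    obtain ⟨F, rfl⟩ := Multiset.exists_cons_of_mem hx
    obtain ⟨M, rfl⟩ := Multiset.exists_cons_of_mem hl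
    cases T with
    | leaf =>
      obtain ⟨hcount, h'⟩ := h.of_leaf fun x hx => hs.le_pend x (Multiset.mem_cons_of_mem hx)
      exact ⟨_, _, _, .leaf hcount, h', by simp [stepBound, size]⟩
    | node a b T T' =>
      obtain ⟨ha, hb, hab, h'⟩ := completes_node_iff.1 h
      have hle := card_le_card_forestDepths ((l + a, T) ::ₘ (l + b, T') ::ₘ F)
      have hM := congrArg Multiset.card h'.map_fst
      have hcard := h'.card
      simp only [Multiset.card_map, Multiset.card_cons] at hle hM hcard
      exact ⟨_, _, _, .split ha hb hab (by omega), h', by simp [stepBound, size]; omega⟩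
  · have hM : M ≠ 0 := by
      rintro rfl
      exact hF (Multiset.map_eq_zero.1 h.map_fst)
    have hlev : l + 1 ≤ K * n := (hs.shift hl hM).lev_le
    exact ⟨_, _, _, .shift hl hM, completes_shift_iff.2 h, by simp only [stepBound]; omega⟩

theorem Completes.exists_reachable (h : Completes K D s F) (hD : D.card = n)
    (hs : s.Valid n K) :
    ∃ s', Relation.ReflTransGen (fun s s' => ∃ mv, Step n K D mv s s') s s' ∧ s'.done = n := by
  induction hw : stepBound n K s F using Nat.strong_induction_on generalizing s F with
  | _ w ih =>
    by_cases hF : F = 0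
    · exact ⟨s, .refl, by simpa [hF, hD] using h.card⟩
    · obtain ⟨mv, s', F', hstep, h', hlt⟩ := h.exists_step hD hs hF
      obtain ⟨t, hreach, ht⟩ := ih _ (hw ▸ hlt) h' (hstep.valid hs) rfl
      exact ⟨t, .head ⟨mv, hstep⟩ hreach, ht⟩

end Conf

theorem Realizable.exists_reachable {n K : ℕ} {D : Multiset ℕ} (h : Realizable (K + 1) D)
    (hD : D.card = n) (hn : 0 < n) : ∃ s, Relation.ReflTransGen
      (fun s s' => ∃ mv, Conf.Step n K D mv s s') Conf.start s ∧ s.done = n := by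
  obtain ⟨T, hT⟩ := h
  exact (Conf.completes_start_iff.2 hT).exists_reachable hD (Conf.valid_start hn)

/-! ### The numbering of the configurations -/

section PowerSums

variable {b w : ℕ} {S T : Multiset ℕ}

theorem pow_le_sum_map_pow {e : ℕ} (he : e ∈ S) : b ^ e ≤ (S.map (b ^ ·)).sum :=
  Multiset.single_le_sum (fun _ _ => Nat.zero_le _) _ (Multiset.mem_map_of_mem _ he)

theorem sum_map_pow_lt_iff (hcard : S.card < b) :
    (S.map (b ^ ·)).sum < b ^ w ↔ ∀ e ∈ S, e < w := by
  have hb : 0 < b := Nat.zero_lt_of_lt hcard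
  refine ⟨fun h e he => ?_, fun h => ?_⟩
  · by_contra! hwe
    exact absurd (pow_le_sum_map_pow he) (h.trans_le (Nat.pow_le_pow_right hb hwe)).not_ge
  · cases w with
    | zero =>
      obtain rfl : S = 0 := Multiset.eq_zero_of_forall_notMem fun e he => absurd (h e he) (by simp)
      simp
    | succ w =>
      calc (S.map (b ^ ·)).sum ≤ S.card * b ^ w := by
            simpa using Multiset.sum_le_card_nsmul (S.map (b ^ ·)) (b ^ w)
              (by simpa using fun e he => Nat.pow_le_pow_right hb (Nat.le_of_lt_succ (h e he)))
        _ < b * b ^ w := Nat.mul_lt_mul_of_pos_right hcard (Nat.pow_pos hb)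
        _ = b ^ (w + 1) := (pow_succ' b w).symm

/-- A multiset with fewer than `b` elements is determined by its numbers of occurrences, read as
digits in base `b`: the largest element is visible in the size of the number. -/
theorem eq_of_sum_map_pow_eq (hS : S.card < b) (hT : T.card < b)
    (h : (S.map (b ^ ·)).sum = (T.map (b ^ ·)).sum) : S = T := by
  induction hm : S.card generalizing S T with
  | zero =>
    obtain rfl := Multiset.card_eq_zero.1 hm
    refine (Multiset.eq_zero_of_forall_notMem fun e he => ?_).symm
    exact absurd (h ▸ pow_le_sum_map_pow he) (by simp [Nat.ne_zero_of_lt hT])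
  | succ m ih =>
    have hS0 : S ≠ 0 := by
      rintro rfl
      simp at hm
    obtain ⟨a, haS, hmax⟩ := S.toFinset.exists_max_image id (Multiset.toFinset_nonempty.2 hS0)
    rw [Multiset.mem_toFinset] at haS
    have hTle : ∀ e ∈ T, e < a + 1 := by
      rw [← sum_map_pow_lt_iff hT, ← h, sum_map_pow_lt_iff hS]
      exact fun e he => Nat.lt_succ_of_le (hmax e (Multiset.mem_toFinset.2 he))
    have haT : a ∈ T := by
      by_contra haT
      have hlt := (sum_map_pow_lt_iff (w := a) hT).2 fun e he =>
        (Nat.le_of_lt_succ (hTle e he)).lt_of_ne fun hea => haT (hea ▸ he)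
      exact absurd (pow_le_sum_map_pow (b := b) haS) (by omega)
    obtain ⟨S, rfl⟩ := Multiset.exists_cons_of_mem haS
    obtain ⟨T, rfl⟩ := Multiset.exists_cons_of_mem haT
    simp only [Multiset.card_cons, Multiset.map_cons, Multiset.sum_cons] at hS hT h hm
    exact congrArg (a ::ₘ ·)
      (ih (S := S) (T := T) (by omega) (by omega) (by omega) (by omega))

end PowerSums

section MixedRadix

variable {X Y x x' y y' : ℕ}

theorem mul_add_lt_mul (hx : x < X) (hy : y < Y) : X * y + x < X * Y :=
  calc X * y + x < X * y + X := by omega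
    _ = X * (y + 1) := (Nat.mul_succ X y).symm
    _ ≤ X * Y := Nat.mul_le_mul_left X hy

theorem eq_and_eq_of_mul_add_eq (hx : x < X) (hx' : x' < X) (h : X * y + x = X * y' + x') :
    y = y' ∧ x = x' := by
  have hX : 0 < X := Nat.zero_lt_of_lt hx
  constructor
  · simpa [Nat.mul_add_div hX, Nat.div_eq_of_lt, hx, hx'] using congrArg (· / X) h
  · simpa [Nat.mul_add_mod, Nat.mod_eq_of_lt, hx, hx'] using congrArg (· % X) h

end MixedRadix

namespace Conf

/-- The number with `K + 1` digits in base `n + 1` that count how often each of the levels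
`l, …, l + K` occurs in `M`, level `l` being the most significant digit. -/
def levelCode (n K l : ℕ) (M : Multiset ℕ) : ℕ :=
  (M.map fun x => (n + 1) ^ (K + l - x)).sum

variable {n K l i j a b mv : ℕ} {D M M' : Multiset ℕ} {s s' : Conf}

theorem levelCode_eq_sum_map_pow :
    levelCode n K l M = ((M.map (K + l - ·)).map ((n + 1) ^ ·)).sum := by
  simp [levelCode, Multiset.map_map]

@[simp]
theorem levelCode_cons_self :
    levelCode n K l (l ::ₘ M) = (n + 1) ^ K + levelCode n K l M := by
  simp [levelCode]

theorem levelCode_cons_cons (ha : 1 ≤ a) (hb : 1 ≤ b) (hab : a + b = K + 1) :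
    levelCode n K l ((l + a) ::ₘ (l + b) ::ₘ M) =
      (n + 1) ^ (b - 1) + (n + 1) ^ (a - 1) + levelCode n K l M := by
  have hexpa : K + l - (l + a) = b - 1 := by omega
  have hexpb : K + l - (l + b) = a - 1 := by omega
  simp [levelCode, hexpa, hexpb, add_assoc]

theorem levelCode_succ (hM : ∀ x ∈ M, x ≤ l + K) :
    levelCode n K (l + 1) M = (n + 1) * levelCode n K l M := by
  rw [levelCode, levelCode, ← Multiset.sum_map_mul_left]
  refine congrArg _ (Multiset.map_congr rfl fun x hx => ?_)
  have hexp : K + (l + 1) - x = K + l - x + 1 := by have := hM x hx; omega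
  rw [hexp, pow_succ']

theorem levelCode_injOn (hM : ∀ x ∈ M, x ≤ l + K) (hM' : ∀ x ∈ M', x ≤ l + K)
    (hcard : M.card ≤ n) (hcard' : M'.card ≤ n)
    (h : levelCode n K l M = levelCode n K l M') : M = M' := by
  have hinv : ∀ {N : Multiset ℕ}, (∀ x ∈ N, x ≤ l + K) →
      (N.map (K + l - ·)).map (K + l - ·) = N := fun {N} hN => by
    rw [Multiset.map_map]
    refine (Multiset.map_congr rfl fun x hx => ?_).trans (Multiset.map_id N)
    have := hN x hx
    simp only [Function.comp_apply, id_eq]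
    omega
  rw [levelCode_eq_sum_map_pow, levelCode_eq_sum_map_pow] at h
  rw [← hinv hM, ← hinv hM', eq_of_sum_map_pow_eq (by simpa using Nat.lt_succ_of_le hcard)
    (by simpa using Nat.lt_succ_of_le hcard') h]

theorem Valid.levelCode_lt_pow_iff (h : s.Valid n K) :
    levelCode n K s.lev s.pend < (n + 1) ^ K ↔ s.lev ∉ s.pend := by
  have hcard := h.card_le
  rw [levelCode_eq_sum_map_pow, sum_map_pow_lt_iff (by simp only [Multiset.card_map]; omega),
    Multiset.forall_mem_map_iff]
  refine ⟨fun hlt hmem => by have := hlt _ hmem; omega, fun hmem x hx => ?_⟩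
  have hne : s.lev ≠ x := fun e => hmem (e ▸ hx)
  have := h.le_pend x hx
  have := h.pend_le x hx
  omega

theorem Valid.levelCode_lt (h : s.Valid n K) :
    levelCode n K s.lev s.pend < (n + 1) ^ (K + 1) := by
  have hcard := h.card_le
  rw [levelCode_eq_sum_map_pow, sum_map_pow_lt_iff (by simp only [Multiset.card_map]; omega),
    Multiset.forall_mem_map_iff]
  exact fun x hx => by have := h.le_pend x hx; omega

/-- The number of the configuration `s` in a numbering in which the steps lead to smaller
numbers. -/
def index (n K : ℕ) (s : Conf) : ℕ :=
  (n + 1) ^ (K + 1) * ((n + 1) * (K * n - s.lev) + (n - s.done)) + levelCode n K s.lev s.pend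

/-- A bound for the numbers assigned by `Conf.index`. -/
def tableSize (n K : ℕ) : ℕ :=
  (n + 1) ^ (K + 1) * ((n + 1) * (K * n + 1))

theorem Valid.index_lt (h : s.Valid n K) : index n K s < tableSize n K :=
  mul_add_lt_mul h.levelCode_lt (mul_add_lt_mul (by omega) (by omega))

theorem Valid.index_injOn (h : s.Valid n K) (h' : s'.Valid n K)
    (heq : index n K s = index n K s') : s = s' := by
  obtain ⟨hdigits, hcode⟩ := eq_and_eq_of_mul_add_eq h.levelCode_lt h'.levelCode_lt heq
  obtain ⟨hlev, hdone⟩ := eq_and_eq_of_mul_add_eq (by omega) (by omega) hdigits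
  obtain ⟨l, i, M⟩ := s
  obtain ⟨l', i', M'⟩ := s'
  obtain ⟨hl, -, hM, -, hcard, -⟩ := h
  obtain ⟨hl', -, hM', -, hcard', -⟩ := h'
  obtain rfl : l = l' := by simp only at *; omega
  obtain rfl : i = i' := by simp only at *; omega
  simp only at hM hM' hcode hcard hcard'
  rw [levelCode_injOn hM hM' (by omega) (by omega) hcode]

theorem Valid.index_leaf (h : Valid n K ⟨l, i, l ::ₘ M⟩) :
    index n K ⟨l, i + 1, M⟩ + (n + 1) ^ (K + 1) + (n + 1) ^ K = index n K ⟨l, i, l ::ₘ M⟩ := by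
  have hi : n - i = n - (i + 1) + 1 := by
    have := h.card_le
    simp only [Multiset.card_cons] at this
    omega
  simp only [index, levelCode_cons_self, hi]
  ring

theorem index_split (ha : 1 ≤ a) (hb : 1 ≤ b) (hab : a + b = K + 1) :
    index n K ⟨l, i, (l + a) ::ₘ (l + b) ::ₘ M⟩ + (n + 1) ^ K =
      index n K ⟨l, i, l ::ₘ M⟩ + ((n + 1) ^ (b - 1) + (n + 1) ^ (a - 1)) := by
  simp only [index, levelCode_cons_cons ha hb hab, levelCode_cons_self]
  ring

theorem Valid.index_shift (h : Valid n K ⟨l + 1, i, M⟩) :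
    index n K ⟨l + 1, i, M⟩ + (n + 1) ^ (K + 1) * (n + 1) + levelCode n K l M =
      index n K ⟨l, i, M⟩ + levelCode n K (l + 1) M := by
  have hl : K * n - l = K * n - (l + 1) + 1 := by
    have := h.lev_le
    simp only at this
    omega
  simp only [index, hl]
  ring

theorem Step.index_lt (h : Step n K D mv s s') (hs : s.Valid n K) :
    index n K s' < index n K s := by
  have hs' := h.valid hs
  have hpos : 0 < (n + 1) ^ K := by positivity
  cases h with
  | shift hl hM =>
    have hle : (n + 1) ^ (K + 1) * 1 ≤ (n + 1) ^ (K + 1) * (n + 1) :=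
      Nat.mul_le_mul_left _ (by omega)
    have hcode := hs'.levelCode_lt
    have hindex := hs'.index_shift
    simp only at hcode
    omega
  | leaf =>
    have := hs.index_leaf
    omega
  | split ha hb hab hn =>
    rename_i b l i M
    have hlt : (n + 1) ^ (b - 1) + (n + 1) ^ (mv - 1) < (n + 1) ^ K := by
      simpa using (sum_map_pow_lt_iff (b := n + 1) (w := K) (S := {b - 1, mv - 1})
        (by simp; omega)).2 (by simp; omega)
    have := index_split (n := n) (l := l) (i := i) (M := M) ha hb hab
    omega

/-! ### Filling the table -/

/-- The address of the `x`-th record of the table, which follows the input and the powers of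
`n + 1`. -/
def cell (n K x : ℕ) : ℕ := n + K + 8 * x

/-- The address of the record of the configuration `s`. -/
def addr (n K : ℕ) (s : Conf) : ℕ := cell n K (index n K s)

/-- The first address after the table. -/
def tableEnd (n K : ℕ) : ℕ := cell n K (tableSize n K)

/-- The record of the configuration `s`, consisting of the number of vertices found so far (which is
nonzero and marks the record as used), the level, the number of finished leaves, the encoded levels
of the pending vertices, the address `p` of the record of the previous configuration, and the code
`mv` of the step that leads from there to `s`. -/
structure IsRecord (n K : ℕ) (m : ℕ → ℕ) (s : Conf) (p mv : ℕ) : Prop where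
  valid : s.Valid n K
  count : m (addr n K s) = s.done + s.pend.card
  lev : m (addr n K s + 1) = s.lev
  done : m (addr n K s + 2) = s.done
  code : m (addr n K s + 3) = 8 * levelCode n K s.lev s.pend
  parent : m (addr n K s + 4) = p
  move : m (addr n K s + 5) = mv

/-- The records in the memory `m` describe a sequence of `j` steps from the start configuration
to `s`. -/
inductive Chain (n K : ℕ) (D : Multiset ℕ) (m : ℕ → ℕ) : ℕ → Conf → Prop where
  | start (hr : IsRecord n K m start 0 0) : Chain n K D m 0 start
  | step {j mv : ℕ} {s s' : Conf} (hc : Chain n K D m j s) (hs : Step n K D mv s s')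
      (hr : IsRecord n K m s' (addr n K s) mv) : Chain n K D m (j + 1) s'

/-- The invariant of the memory while the table is filled. -/
structure Table (n K : ℕ) (d : List ℕ) (m : ℕ → ℕ) : Prop where
  input : ∀ p < n, m p = d.getD p 0
  pow : ∀ e < K, m (n + e) = 8 * (n + 1) ^ e
  chain : ∀ x, m (cell n K x) ≠ 0 → ∃ j s, Chain n K d m j s ∧ index n K s = x
  start : m (addr n K start) ≠ 0

/-- Existing records are not changed, and no records with a number at least `b` are added. -/
structure Grows (n K b : ℕ) (m m' : ℕ → ℕ) : Prop where
  record : ∀ x, m (cell n K x) ≠ 0 → ∀ f < 8, m' (cell n K x + f) = m (cell n K x + f)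
  mark : ∀ x, b ≤ x → m' (cell n K x) = m (cell n K x)

section Table

variable {p : ℕ} {d : List ℕ} {m m' m'' : ℕ → ℕ}

theorem index_start : index n K start + (n + 1) ^ (K + 1) = tableSize n K + (n + 1) ^ K := by
  simp only [index, start, levelCode, tableSize, Multiset.map_singleton, Multiset.sum_singleton,
    Nat.sub_zero, add_zero]
  ring

theorem IsRecord.count_ne_zero (h : IsRecord n K m s p mv) : m (addr n K s) ≠ 0 := by
  have := h.valid.card_pos
  rw [h.count]
  omega

theorem IsRecord.congr (h : IsRecord n K m s p mv)
    (hm : ∀ f < 8, m' (addr n K s + f) = m (addr n K s + f)) : IsRecord n K m' s p mv := by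
  obtain ⟨hvalid, hcount, hlev, hdone, hcode, hparent, hmove⟩ := h
  exact ⟨hvalid, (hm 0 (by omega)).trans hcount, (hm 1 (by omega)).trans hlev,
    (hm 2 (by omega)).trans hdone, (hm 3 (by omega)).trans hcode,
    (hm 4 (by omega)).trans hparent, (hm 5 (by omega)).trans hmove⟩

theorem Chain.exists_isRecord (h : Chain n K D m j s) : ∃ p mv, IsRecord n K m s p mv := by
  cases h with
  | start hr => exact ⟨_, _, hr⟩
  | step _ _ hr => exact ⟨_, _, hr⟩

theorem Chain.valid (h : Chain n K D m j s) : s.Valid n K :=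
  let ⟨_, _, hr⟩ := h.exists_isRecord
  hr.valid

theorem Chain.congr (h : Chain n K D m j s)
    (hm : ∀ x, m (cell n K x) ≠ 0 → ∀ f < 8, m' (cell n K x + f) = m (cell n K x + f)) :
    Chain n K D m' j s := by
  induction h with
  | start hr => exact .start (hr.congr (hm _ hr.count_ne_zero))
  | step _ hs hr ih => exact .step ih hs (hr.congr (hm _ hr.count_ne_zero))

theorem Chain.index_add_le (h : Chain n K D m j s) : index n K s + j ≤ index n K Conf.start := by
  induction h with
  | start => simp
  | step hc hs _ ih =>
    have := hs.index_lt hc.valid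
    omega

theorem Grows.refl (n K b : ℕ) (m : ℕ → ℕ) : Grows n K b m m :=
  ⟨fun _ _ _ _ => rfl, fun _ _ => rfl⟩

theorem Grows.mark_ne_zero {x : ℕ} (h : Grows n K b m m') (hx : m (cell n K x) ≠ 0) :
    m' (cell n K x) ≠ 0 := by
  rw [← add_zero (cell n K x), h.record x hx 0 (by omega)]
  exact hx

theorem Grows.trans (h : Grows n K b m m') (h' : Grows n K b m' m'') : Grows n K b m m'' :=
  ⟨fun x hx f hf => (h'.record x (h.mark_ne_zero hx) f hf).trans (h.record x hx f hf),
    fun x hx => (h'.mark x hx).trans (h.mark x hx)⟩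

theorem Chain.grows (h : Chain n K D m j s) (hg : Grows n K b m m') : Chain n K D m' j s :=
  h.congr hg.record

theorem grows_of_eq_off_record (h : index n K s < b) (hs : m (addr n K s) = 0)
    (hm : ∀ q, q < addr n K s ∨ addr n K s + 8 ≤ q → m' q = m q) : Grows n K b m m' := by
  unfold addr cell at *
  refine ⟨fun x hx f hf => hm _ ?_, fun x hx => hm _ (by unfold cell; omega)⟩
  have : x ≠ index n K s := by
    rintro rfl
    exact hx hs
  unfold cell
  omega

theorem table_start (hinput : ∀ q < n, m q = d.getD q 0)
    (hpow : ∀ e < K, m (n + e) = 8 * (n + 1) ^ e) (hzero : ∀ q, n + K ≤ q → m q = 0)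
    (hm : ∀ q, q < addr n K start ∨ addr n K start + 8 ≤ q → m' q = m q)
    (hr : IsRecord n K m' start 0 0) : Table n K d m' := by
  refine ⟨fun q hq => ?_, fun e he => ?_, fun x hx => ?_, hr.count_ne_zero⟩
  · rw [hm q (by unfold addr cell; omega), hinput q hq]
  · rw [hm _ (by unfold addr cell; omega), hpow e he]
  · refine ⟨0, start, .start hr, ?_⟩
    by_contra hne
    refine hx ((hm _ ?_).trans (hzero _ ?_)) <;> unfold addr cell at * <;> omega

theorem Table.add_record (h : Table n K d m) (hc : Chain n K d m j s) (hs : Step n K d mv s s')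
    (hzero : m (addr n K s') = 0)
    (hm : ∀ q, q < addr n K s' ∨ addr n K s' + 8 ≤ q → m' q = m q)
    (hr : IsRecord n K m' s' (addr n K s) mv) : Table n K d m' := by
  have hg := grows_of_eq_off_record (hs.index_lt hc.valid) hzero hm
  refine ⟨fun q hq => ?_, fun e he => ?_, fun x hx => ?_, hg.mark_ne_zero h.start⟩
  · rw [hm q (by unfold addr cell; omega), h.input q hq]
  · rw [hm _ (by unfold addr cell; omega), h.pow e he]
  · by_cases hxs : x = index n K s'
    · exact ⟨_, _, .step (hc.grows hg) hs hr, hxs.symm⟩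
    · rw [hm _ (by unfold addr cell; omega)] at hx
      obtain ⟨j, t, ht, hx⟩ := h.chain x hx
      exact ⟨j, t, ht.grows hg, hx⟩

end Table

open RAM

/-- The values of the registers that are constant after the initialization. -/
structure Env (n K : ℕ) (r : ℕ → ℕ) : Prop where
  reg_n : r rN = n
  reg_one : r rOne = 1
  reg_delta : r rDelta = K
  reg_base : r rBase = n + 1
  reg_pow : r rPow = 8 * (n + 1) ^ K
  reg_row : r rRow = 8 * (n + 1) ^ (K + 1)
  reg_layer : r rLayer = 8 * (n + 1) ^ (K + 2)
  reg_table : r rTable = n + K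
  reg_end : r rEnd = tableEnd n K
  reg_eight : r rEight = 8

/-- The machine is about to perform the steps from the configuration `s`, whose record has been
loaded. -/
structure AtRecord (n K : ℕ) (d : List ℕ) (s : Conf) (σ : State) : Prop where
  env : Env n K σ.reg
  table : Table n K d σ.mem
  chain : ∃ j, Chain n K d σ.mem j s
  reg_addr : σ.reg rAddr = addr n K s
  reg_count : σ.reg rCount = s.done + s.pend.card
  reg_lev : σ.reg rLev = s.lev
  reg_done : σ.reg rDone = s.done
  reg_code : σ.reg rCode = 8 * levelCode n K s.lev s.pend

/-- The state `σ'` may be reached from `σ` by performing some of the steps from `s`. -/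
structure After (n K : ℕ) (d : List ℕ) (s : Conf) (σ σ' : State) : Prop where
  atRecord : AtRecord n K d s σ'
  grows : Grows n K (index n K s) σ.mem σ'.mem
  reg : ∀ r < rTest, σ'.reg r = σ.reg r

/-- The registers describe a record for `s`, to be written by `markProg`. -/
structure HoldsRecord (n K : ℕ) (s : Conf) (mv : ℕ) (σ : State) : Prop where
  reg_addr : σ.reg rNewAddr = addr n K s
  reg_count : σ.reg rNewCount = s.done + s.pend.card
  reg_lev : σ.reg rNewLev = s.lev
  reg_done : σ.reg rNewDone = s.done
  reg_code : σ.reg rNewCode = 8 * levelCode n K s.lev s.pend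
  reg_move : σ.reg rNewMove = mv

section Steps

variable {d : List ℕ} {σ σ' σ'' : State} {P : Prog} {T : ℕ} {Q : State → Prop}

theorem Env.congr {r r' : ℕ → ℕ} (h : Env n K r) (hr : ∀ x < rGoal, r' x = r x) :
    Env n K r' := by
  obtain ⟨h0, h2, h3, h4, h5, h6, h7, h8, h9, h10⟩ := h
  constructor <;> rw [hr _ (by omega)] <;> assumption

theorem AtRecord.after (h : AtRecord n K d s σ) (ht : Table n K d σ'.mem)
    (hg : Grows n K (index n K s) σ.mem σ'.mem) (hr : ∀ r < rTest, σ'.reg r = σ.reg r) :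
    After n K d s σ σ' := by
  obtain ⟨henv, -, ⟨j, hc⟩, haddr, hcount, hlev, hdone, hcode⟩ := h
  refine ⟨⟨henv.congr fun r hlt => hr r (by omega), ht, ⟨j, hc.grows hg⟩, ?_, ?_, ?_, ?_, ?_⟩, hg,
    hr⟩ <;> rw [hr _ (by omega)] <;> assumption

theorem After.trans (h : After n K d s σ σ') (h' : After n K d s σ' σ'') :
    After n K d s σ σ'' :=
  ⟨h'.atRecord, h.grows.trans h'.grows, fun r hr => (h'.reg r hr).trans (h.reg r hr)⟩

theorem AtRecord.after_of_mem_eq (h : AtRecord n K d s σ) (hm : σ'.mem = σ.mem)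
    (hr : ∀ r < rTest, σ'.reg r = σ.reg r) : After n K d s σ σ' :=
  h.after (hm ▸ h.table) (hm ▸ .refl _ _ _ _) hr

theorem AtRecord.and_after (h : AtRecord n K d s σ) (hP : HaltsWithin P σ T Q)
    (hst : P.storeFree = true) (ht : ∀ r ∈ P.targets, rTest ≤ r) :
    HaltsWithin P σ T fun σ' => Q σ' ∧ After n K d s σ σ' :=
  (hP.and_reg_eq.and_mem_eq hst).imp fun _ ⟨⟨hQ, hr⟩, hm⟩ =>
    ⟨hQ, h.after_of_mem_eq hm fun r hlt => hr r fun hmem => (ht r hmem).not_gt hlt⟩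

/-- Write a new record, unless there is one already. -/
def markProg : Prog :=
  .seq (.load rTmp rNewAddr) (.branch rTmp .skip (.block [
    .store rNewAddr rNewCount, .add rPtr rNewAddr rOne, .store rPtr rNewLev,
    .add rPtr rPtr rOne, .store rPtr rNewDone, .add rPtr rPtr rOne, .store rPtr rNewCode,
    .add rPtr rPtr rOne, .store rPtr rAddr, .add rPtr rPtr rOne, .store rPtr rNewMove]))

theorem HoldsRecord.run_markProg (h : HoldsRecord n K s mv σ) (hone : σ.reg rOne = 1)
    (hs : s.Valid n K) (hm : σ.mem (addr n K s) = 0) :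
    IsRecord n K (markProg.run σ).mem s (σ.reg rAddr) mv ∧
      ∀ q, q < addr n K s ∨ addr n K s + 8 ≤ q → (markProg.run σ).mem q = σ.mem q := by
  have hrun : (markProg.run σ).mem = Function.update (Function.update (Function.update
      (Function.update (Function.update (Function.update σ.mem (addr n K s)
        (s.done + s.pend.card)) (addr n K s + 1) s.lev) (addr n K s + 2) s.done)
          (addr n K s + 3) (8 * levelCode n K s.lev s.pend)) (addr n K s + 4) (σ.reg rAddr))
            (addr n K s + 5) mv := by
    simp [markProg, h.reg_addr, h.reg_count, h.reg_lev, h.reg_done, h.reg_code, h.reg_move, hone,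
      hm, add_assoc]
  rw [hrun]
  refine ⟨⟨hs, ?_, ?_, ?_, ?_, ?_, ?_⟩, fun q hq => ?_⟩
  iterate 6 simp
  repeat rw [Function.update_of_ne (by omega)]

theorem haltsWithin_markProg (h : AtRecord n K d s σ) (hs : Step n K d mv s s')
    (h' : HoldsRecord n K s' mv σ) :
    HaltsWithin markProg σ 14 fun σ' => After n K d s σ σ' ∧ σ'.mem (addr n K s') ≠ 0 := by
  obtain ⟨j, hc⟩ := h.chain
  refine ((HaltsWithin.of_loopFree (Q := fun σ' => Table n K d σ'.mem ∧
    Grows n K (index n K s) σ.mem σ'.mem ∧ σ'.mem (addr n K s') ≠ 0) rfl ?_).and_reg_eq.of_le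
      (by decide)).imp fun σ' ⟨⟨htable, hgrows, hmark⟩, hr⟩ =>
        ⟨h.after htable hgrows fun r hlt => hr r fun hmem => ?_, hmark⟩
  · by_cases hm : σ.mem (addr n K s') = 0
    · obtain ⟨hr, hoff⟩ := h'.run_markProg h.env.reg_one (hs.valid hc.valid) hm
      exact ⟨h.table.add_record hc hs hm hoff (h.reg_addr ▸ hr),
        grows_of_eq_off_record (hs.index_lt hc.valid) hm hoff, hr.count_ne_zero⟩
    · have hrun : (markProg.run σ).mem = σ.mem := by simp [markProg, h'.reg_addr, hm]
      rw [hrun]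
      exact ⟨h.table, .refl _ _ _ _, hm⟩
  · have htargets : ∀ r ∈ markProg.targets, rTest ≤ r := by decide
    exact (htargets r hmem).not_gt hlt

theorem haltsWithin_block_markProg {l : List Prog} (h : AtRecord n K d s σ)
    (hs : Step n K d mv s s') (hl : (Prog.block l).loopFree = true)
    (hst : (Prog.block l).storeFree = true) (ht : ∀ r ∈ (Prog.block l).targets, rTest ≤ r)
    (h' : HoldsRecord n K s' mv ((Prog.block l).run σ)) :
    HaltsWithin (.seq (.block l) markProg) σ ((Prog.block l).cost + 14) fun σ' =>
      After n K d s σ σ' ∧ σ'.mem (addr n K s') ≠ 0 :=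
  (h.and_after (.of_loopFree hl h') hst ht).seq fun _ ⟨hσ, hafter⟩ =>
    (haltsWithin_markProg hafter.atRecord hs hσ).imp fun _ ⟨h, hm⟩ => ⟨hafter.trans h, hm⟩

/-- Count the elements of the signature that are less than the level. -/
def countProg : Prog :=
  .seq (.block [.const rAcc 0, .copy rIter rN]) (.loop rIter (.block [
    .sub rIter rIter rOne, .load rTmp rIter, .sub rTmp rLev rTmp,
    .branch rTmp (.add rAcc rAcc rOne) .skip]))

theorem haltsWithin_countProg (h : AtRecord n K d s σ) (hd : d.length = n) :
    HaltsWithin countProg σ (7 * n + 4) fun σ' =>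
      σ'.reg rAcc = d.countP (· < s.lev) ∧ After n K d s σ σ' := by
  have hstart := h.and_after (P := .block [.const rAcc 0, .copy rIter rN])
    (.of_loopFree (Q := fun σ' => σ'.reg rIter = n ∧ σ'.reg rAcc = 0) rfl
      (by simp [h.env.reg_n])) rfl (by decide)
  refine (hstart.seq fun τ hτ => (HaltsWithin.loop (T := 6) (I := fun j σ' =>
    (σ'.reg rIter = j ∧ j ≤ n ∧ σ'.reg rAcc = (d.drop j).countP (· < s.lev)) ∧ After n K d s σ σ')
    (fun _ hσ => hσ.1.1) ?_ n τ ?_).imp fun σ' hσ => ⟨by simpa using hσ.1.2.2, hσ.2⟩).of_le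
      (by simp only [Prog.cost, Prog.block]; omega)
  · rintro j τ ⟨⟨hj, hle, hacc⟩, hτ⟩
    refine ⟨by omega, (hτ.atRecord.and_after (.of_loopFree rfl ?_) rfl (by decide)).imp
      fun _ ⟨hQ, hτ'⟩ => ⟨hQ, hτ.trans hτ'⟩⟩
    have hdrop : d.drop j = d.getD j 0 :: d.drop (j + 1) := by
      rw [List.drop_eq_getElem_cons (by omega), List.getD_eq_getElem _ _ (by omega)]
    by_cases hlev : s.lev ≤ d.getD j 0 <;>
      simp [hj, hτ.atRecord.env.reg_one, hτ.atRecord.reg_lev, hτ.atRecord.table.input j hle, hdrop,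
        List.countP_cons, hacc, hlev, Nat.sub_eq_zero_iff_le, Nat.le_of_succ_le hle, -not_le,
        -List.getD_eq_getElem?_getD]
  · exact ⟨⟨hτ.1.1, le_rfl, by simp [hτ.1.2, ← hd]⟩, hτ.2⟩

/-- All configurations that follow `s` have been recorded. -/
def Closed (n K : ℕ) (D : Multiset ℕ) (m : ℕ → ℕ) (s : Conf) : Prop :=
  ∀ mv s', Step n K D mv s s' → m (addr n K s') ≠ 0

theorem Closed.grows {m m' : ℕ → ℕ} (h : Closed n K D m s) (hg : Grows n K b m m') :
    Closed n K D m' s :=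
  fun mv s' hs => hg.mark_ne_zero (h mv s' hs)

theorem closed_of_notMem {m : ℕ → ℕ} (hl : l ∉ M)
    (h : M ≠ 0 → m (addr n K ⟨l + 1, i, M⟩) ≠ 0) : Closed n K D m ⟨l, i, M⟩ := by
  intro mv s' hs
  cases hs with
  | shift _ hM => exact h hM
  | leaf | split => simp at hl

theorem closed_cons {m : ℕ → ℕ}
    (hleaf : D.countP (· < l) ≤ i → m (addr n K ⟨l, i + 1, M⟩) ≠ 0)
    (hsplit : ∀ a b, 1 ≤ a → 1 ≤ b → a + b = K + 1 → i + M.card + 1 < n →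
      m (addr n K ⟨l, i, (l + a) ::ₘ (l + b) ::ₘ M⟩) ≠ 0) :
    Closed n K D m ⟨l, i, l ::ₘ M⟩ := by
  intro mv s' hs
  generalize hs₀ : (⟨l, i, l ::ₘ M⟩ : Conf) = s₀ at hs
  cases hs <;> simp only [mk.injEq] at hs₀ <;> obtain ⟨rfl, rfl, hM⟩ := hs₀
  case shift _ hl => exact absurd (hM ▸ Multiset.mem_cons_self _ _) hl
  case leaf hD =>
    obtain rfl := Multiset.cons_inj_right _ |>.1 hM
    exact hleaf hD
  case split hb ha hab hn =>
    obtain rfl := Multiset.cons_inj_right _ |>.1 hM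
    exact hsplit _ _ ha hb hab hn

/-- Make the vertex on the current level a leaf, unless too few leaves are finished. -/
def leafProg : Prog :=
  .seq countProg (.seq (.sub rTest rAcc rDone) (.branch rTest .skip (.seq (.block [
    .sub rNewAddr rAddr rRow, .sub rNewAddr rNewAddr rPow, .copy rNewCount rCount,
    .copy rNewLev rLev, .add rNewDone rDone rOne, .sub rNewCode rCode rPow,
    .add rNewMove rDelta rOne]) markProg)))

theorem AtRecord.valid (h : AtRecord n K d s σ) : s.Valid n K :=
  let ⟨_, hc⟩ := h.chain
  hc.valid

theorem addr_leaf (h : Valid n K ⟨l, i, l ::ₘ M⟩) :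
    addr n K ⟨l, i + 1, M⟩ =
      addr n K ⟨l, i, l ::ₘ M⟩ - 8 * (n + 1) ^ (K + 1) - 8 * (n + 1) ^ K := by
  have := h.index_leaf
  unfold addr cell
  omega

theorem haltsWithin_leafProg (h : AtRecord n K d ⟨l, i, l ::ₘ M⟩ σ) (hd : d.length = n) :
    HaltsWithin leafProg σ (7 * n + 28) fun σ' => After n K d ⟨l, i, l ::ₘ M⟩ σ σ' ∧
      (d.countP (· < l) ≤ i → σ'.mem (addr n K ⟨l, i + 1, M⟩) ≠ 0) := by
  refine ((haltsWithin_countProg h hd).seq fun τ ⟨hacc, hτ⟩ => (hτ.atRecord.and_after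
    (.of_loopFree (Q := fun σ' => σ'.reg rTest = d.countP (· < l) - i) rfl ?_) rfl
      (by decide)).seq fun τ' ⟨htest, hτ'⟩ => .branch (T := 22) (fun hne => ?_) fun heq => ?_).of_le
        (by simp only [Prog.cost]; omega)
  · simp [hacc, hτ.atRecord.reg_done]
  · refine (HaltsWithin.of_loopFree (Q := (· = τ')) rfl rfl).of_le (by decide) |>.imp ?_
    rintro _ rfl
    exact ⟨hτ.trans hτ', fun hle => absurd (htest ▸ hne) (by omega)⟩
  · have hle : d.countP (· < l) ≤ i := by omega
    have hat := hτ'.atRecord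
    refine ((haltsWithin_block_markProg hat (.leaf (by simpa using hle)) rfl rfl (by decide)
      ?_).of_le (by decide)).imp fun _ ⟨h, hm⟩ => ⟨(hτ.trans hτ').trans h, fun _ => hm⟩
    have := hat.env
    constructor <;> simp [hat.reg_addr, addr_leaf hat.valid, hat.env.reg_one, hat.env.reg_row,
      hat.env.reg_pow, hat.env.reg_delta, hat.reg_count, hat.reg_lev, hat.reg_done, hat.reg_code,
      levelCode_cons_self, mul_add, add_comm, add_left_comm]

theorem addr_split (ha : 1 ≤ a) (hb : 1 ≤ b) (hab : a + b = K + 1) :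
    addr n K ⟨l, i, (l + a) ::ₘ (l + b) ::ₘ M⟩ = addr n K ⟨l, i, l ::ₘ M⟩ +
      (8 * (n + 1) ^ (b - 1) + 8 * (n + 1) ^ (a - 1)) - 8 * (n + 1) ^ K := by
  have := index_split (n := n) (l := l) (i := i) (M := M) ha hb hab
  unfold addr cell
  omega

/-- Make the vertex on the current level an internal one, where the first edge has the length given
by the register `rIter`. -/
def splitBlock : List Prog := [
  .sub rTmp rDelta rIter, .add rPtr rN rTmp, .load rNewCode rPtr, .add rPtr rN rIter,
  .sub rPtr rPtr rOne, .load rTmp rPtr, .add rNewCode rNewCode rTmp,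
  .add rNewAddr rAddr rNewCode, .sub rNewAddr rNewAddr rPow, .add rNewCode rNewCode rCode,
  .sub rNewCode rNewCode rPow, .add rNewCount rCount rOne, .copy rNewLev rLev,
  .copy rNewDone rDone, .copy rNewMove rIter]

theorem AtRecord.holdsRecord_splitBlock (h : AtRecord n K d ⟨l, i, l ::ₘ M⟩ σ) (ha : 1 ≤ a)
    (hb : 1 ≤ b) (hab : a + b = K + 1) (hiter : σ.reg rIter = a) :
    HoldsRecord n K ⟨l, i, (l + a) ::ₘ (l + b) ::ₘ M⟩ a ((Prog.block splitBlock).run σ) := by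
  have hK : K - a = b - 1 := by omega
  have hpred : n + a - 1 = n + (a - 1) := by omega
  constructor <;> simp [splitBlock, hiter, h.env.reg_n, h.env.reg_one, h.env.reg_delta,
    h.env.reg_pow, h.reg_addr, h.reg_count, h.reg_lev, h.reg_done, h.reg_code, hK, hpred,
    h.table.pow (b - 1) (by omega), h.table.pow (a - 1) (by omega), addr_split ha hb hab,
    levelCode_cons_cons ha hb hab, add_assoc]
  ring_nf
  omega

theorem haltsWithin_splitBlock (h : AtRecord n K d ⟨l, i, l ::ₘ M⟩ σ) (ha : 1 ≤ a) (hb : 1 ≤ b)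
    (hab : a + b = K + 1) (hn : i + M.card + 1 < n) (hiter : σ.reg rIter = a) :
    HaltsWithin (.seq (.seq (.block splitBlock) markProg) (.sub rIter rIter rOne)) σ 31 fun σ' =>
      σ'.reg rIter = a - 1 ∧ After n K d ⟨l, i, l ::ₘ M⟩ σ σ' ∧
        σ'.mem (addr n K ⟨l, i, (l + a) ::ₘ (l + b) ::ₘ M⟩) ≠ 0 := by
  refine ((haltsWithin_block_markProg h (.split ha hb hab hn) rfl rfl (by decide)
    (h.holdsRecord_splitBlock ha hb hab hiter)).and_reg_eq.seq fun τ ⟨⟨hτ, hm⟩, hreg⟩ =>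
      (hτ.atRecord.and_after (.of_loopFree (Q := fun σ' => σ'.reg rIter = a - 1 ∧ σ'.mem = τ.mem)
        rfl ?_) rfl (by decide)).imp fun υ ⟨⟨hiter', hmem⟩, hυ⟩ =>
          ⟨hiter', hτ.trans hυ, hmem ▸ hm⟩).of_le (by decide)
  simp [hτ.atRecord.env.reg_one, hreg rIter (by decide), hiter]

/-- Make the vertex on the current level an internal one in all possible ways, unless there are too
many vertices. -/
def splitProg : Prog :=
  .seq (.block [.sub rTest rN rCount, .copy rIter rDelta]) (.branch rTest
    (.loop rIter (.seq (.seq (.block splitBlock) markProg) (.sub rIter rIter rOne))) .skip)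

theorem haltsWithin_splitProg (h : AtRecord n K d ⟨l, i, l ::ₘ M⟩ σ) :
    HaltsWithin splitProg σ (32 * K + 5) fun σ' => After n K d ⟨l, i, l ::ₘ M⟩ σ σ' ∧
      ∀ a b, 1 ≤ a → 1 ≤ b → a + b = K + 1 → i + M.card + 1 < n →
        σ'.mem (addr n K ⟨l, i, (l + a) ::ₘ (l + b) ::ₘ M⟩) ≠ 0 := by
  refine ((h.and_after (.of_loopFree (Q := fun σ' => σ'.reg rTest = n - (i + M.card + 1) ∧
    σ'.reg rIter = K) rfl ?_) rfl (by decide)).seq fun τ ⟨⟨htest, hiter⟩, hτ⟩ =>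
      .branch (T := K * (31 + 1) + 1) (fun hne => ?_) fun heq => ?_).of_le
        (by simp only [Prog.cost, Prog.block]; omega)
  · simp [h.reg_count, h.env.reg_n, h.env.reg_delta, add_assoc]
  · refine (HaltsWithin.loop (I := fun j σ' => (σ'.reg rIter = j ∧ j ≤ K) ∧
      After n K d ⟨l, i, l ::ₘ M⟩ σ σ' ∧ ∀ a b, j < a → 1 ≤ b → a + b = K + 1 →
        σ'.mem (addr n K ⟨l, i, (l + a) ::ₘ (l + b) ::ₘ M⟩) ≠ 0) (fun _ hσ => hσ.1.1)
      (fun j τ ⟨⟨hj, _⟩, hτ, hmark⟩ => ⟨by omega, ?_⟩) K τ ⟨⟨hiter, le_rfl⟩, hτ, by omega⟩).imp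
        fun σ' hσ => ⟨hσ.2.1, fun a b ha hb hab _ => hσ.2.2 a b ha hb hab⟩
    refine (haltsWithin_splitBlock hτ.atRecord (a := j + 1) (b := K - j) (by omega) (by omega)
      (by omega) (by omega) hj).imp fun σ' ⟨hiter', hτ', hm⟩ =>
        ⟨⟨hiter', by omega⟩, hτ.trans hτ', fun a b ha hb hab => ?_⟩
    obtain rfl | hlt := Nat.eq_or_lt_of_le (Nat.succ_le_of_lt ha)
    · obtain rfl : b = K - j := by omega
      exact hm
    · exact hτ'.grows.mark_ne_zero (hmark a b hlt hb hab)
  · refine ((HaltsWithin.of_loopFree (Q := (· = τ)) rfl rfl).of_le (by simp [Prog.cost])).imp ?_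
    rintro _ rfl
    exact ⟨hτ, by omega⟩

theorem Valid.addr_shift (h : Valid n K ⟨l, i, M⟩) (hl : l ∉ M) (hM : M ≠ 0) :
    addr n K ⟨l + 1, i, M⟩ = addr n K ⟨l, i, M⟩ - 8 * (n + 1) ^ (K + 2) -
      8 * levelCode n K l M + 8 * levelCode n K (l + 1) M := by
  have hindex := (h.shift hl hM).index_shift
  have hle : levelCode n K (l + 1) M ≤ index n K ⟨l + 1, i, M⟩ := Nat.le_add_left _ _
  rw [pow_succ (n + 1) (K + 1)]
  unfold addr cell
  omega

/-- Pass to the next level, if there are pending vertices. -/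
def shiftProg : Prog :=
  .seq (.sub rTest rCount rDone) (.branch rTest
    (.seq (.mul rNewCode rCode rBase rIter) (.seq (.block [
      .sub rNewAddr rAddr rLayer, .sub rNewAddr rNewAddr rCode, .add rNewAddr rNewAddr rNewCode,
      .copy rNewCount rCount, .add rNewLev rLev rOne, .copy rNewDone rDone, .const rNewMove 0])
        markProg)) .skip)

theorem haltsWithin_shiftProg (h : AtRecord n K d ⟨l, i, M⟩ σ) (hl : l ∉ M) :
    HaltsWithin shiftProg σ (3 * n + 30) fun σ' => After n K d ⟨l, i, M⟩ σ σ' ∧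
      (M ≠ 0 → σ'.mem (addr n K ⟨l + 1, i, M⟩) ≠ 0) := by
  refine ((h.and_after (.of_loopFree (Q := fun σ' => σ'.reg rTest = M.card) rfl
    ?_) rfl (by decide)).seq fun τ ⟨htest, hτ⟩ => .branch (T := 3 * (n + 1) + 3 + 22)
      (fun hne => ?_) fun heq => ?_).of_le (by simp only [Prog.cost]; omega)
  · simp [h.reg_count, h.reg_done]
  · have hM : M ≠ 0 := by
      rintro rfl
      exact hne htest
    refine (hτ.atRecord.and_after (haltsWithin_mul hτ.atRecord.env.reg_one hτ.atRecord.reg_code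
      hτ.atRecord.env.reg_base (by decide)) rfl (by decide)).seq fun υ ⟨hcode, hυ⟩ =>
        ((haltsWithin_block_markProg hυ.atRecord (.shift hl hM) rfl rfl (by decide) ?_).of_le
          (by decide)).imp fun _ ⟨h, hm⟩ => ⟨(hτ.trans hυ).trans h, fun _ => hm⟩
    have hat := hυ.atRecord
    have hmul : υ.reg rNewCode = 8 * levelCode n K (l + 1) M := by
      rw [hcode, levelCode_succ h.valid.pend_le]
      ring
    constructor <;> simp [hmul, hat.reg_addr, h.valid.addr_shift hl hM, hat.env.reg_layer,
      hat.env.reg_one, hat.reg_count, hat.reg_lev, hat.reg_done, hat.reg_code]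
  · refine ((HaltsWithin.of_loopFree (Q := (· = τ)) rfl rfl).of_le (by simp [Prog.cost])).imp ?_
    rintro _ rfl
    exact ⟨hτ, fun hM => absurd (Multiset.card_eq_zero.1 (htest ▸ heq)) hM⟩

/-- Perform all steps from the current configuration. -/
def expandProg : Prog :=
  .seq (.block [.add rTest rCode rOne, .sub rTest rTest rPow])
    (.branch rTest (.seq leafProg splitProg) shiftProg)

theorem haltsWithin_expandProg (h : AtRecord n K d s σ) (hd : d.length = n) :
    HaltsWithin expandProg σ (7 * n + 32 * K + 37) fun σ' =>
      After n K d s σ σ' ∧ Closed n K d σ'.mem s := by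
  refine ((h.and_after (.of_loopFree (Q := fun σ' => σ'.reg rTest =
    8 * levelCode n K s.lev s.pend + 1 - 8 * (n + 1) ^ K) rfl ?_) rfl (by decide)).seq
      fun τ ⟨htest, hτ⟩ => .branch (T := 7 * n + 32 * K + 33) (fun hne => ?_) fun heq => ?_).of_le
        (by simp only [Prog.cost, Prog.block]; omega)
  · simp [h.reg_code, h.env.reg_one, h.env.reg_pow]
  · have hmem : s.lev ∈ s.pend := by
      rw [← not_not (a := _ ∈ _), ← h.valid.levelCode_lt_pow_iff]
      omega
    obtain ⟨l, i, M⟩ := s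
    obtain ⟨M', hM⟩ := Multiset.exists_cons_of_mem hmem
    obtain rfl : M = l ::ₘ M' := hM
    refine ((haltsWithin_leafProg hτ.atRecord hd).seq fun υ ⟨hυ, hleaf⟩ =>
      (haltsWithin_splitProg hυ.atRecord).imp fun _ ⟨hafter, hsplit⟩ =>
        ⟨(hτ.trans hυ).trans hafter, closed_cons (fun hD => ?_) hsplit⟩).of_le (by omega)
    exact hafter.grows.mark_ne_zero (hleaf (by simpa using hD))
  · have hmem : s.lev ∉ s.pend := by
      rw [← h.valid.levelCode_lt_pow_iff]
      omega
    exact ((haltsWithin_shiftProg hτ.atRecord hmem).imp fun _ ⟨hafter, hshift⟩ =>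
      ⟨hτ.trans hafter, closed_of_notMem hmem hshift⟩).of_le (by omega)

/-- Load the rest of the current record. -/
def loadProg : Prog :=
  .block [.add rPtr rAddr rOne, .load rLev rPtr, .add rPtr rPtr rOne, .load rDone rPtr,
    .add rPtr rPtr rOne, .load rCode rPtr]

theorem atRecord_run_loadProg (henv : Env n K σ.reg) (htable : Table n K d σ.mem)
    (hc : Chain n K d σ.mem j s) (haddr : σ.reg rAddr = addr n K s)
    (hcount : σ.reg rCount = σ.mem (addr n K s)) : AtRecord n K d s (loadProg.run σ) := by
  obtain ⟨p, mv, hr⟩ := hc.exists_isRecord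
  refine ⟨henv.congr fun x hx => ?_, htable, ⟨j, hc⟩, ?_, ?_, ?_, ?_, ?_⟩
  · simp only [Prog.run, Prog.block, loadProg, State.reg_setReg]
    repeat rw [if_neg (by omega)]
  all_goals simp [loadProg, henv.reg_one, haddr, hcount, hr.count, hr.lev, hr.done, hr.code,
    add_assoc]

/-- Perform all steps from the current configuration, and note whether it is final. -/
def visitProg : Prog :=
  .seq loadProg (.seq expandProg
    (.seq (.sub rTest rN rDone) (.branch rTest .skip (.copy rGoal rAddr))))

/-- The state `σ'` arises from `σ` by visiting the record of `s`. -/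
structure Visited (n K : ℕ) (d : List ℕ) (s : Conf) (σ σ' : State) : Prop where
  env : Env n K σ'.reg
  table : Table n K d σ'.mem
  grows : Grows n K (index n K s) σ.mem σ'.mem
  closed : Closed n K d σ'.mem s
  reg_sweep : σ'.reg rSweep = σ.reg rSweep
  reg_goal : σ'.reg rGoal = if s.done = n then addr n K s else σ.reg rGoal

theorem haltsWithin_visitProg (henv : Env n K σ.reg) (htable : Table n K d σ.mem)
    (hc : Chain n K d σ.mem j s) (haddr : σ.reg rAddr = addr n K s)
    (hcount : σ.reg rCount = σ.mem (addr n K s)) (hd : d.length = n) :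
    HaltsWithin visitProg σ (7 * n + 32 * K + 47) (Visited n K d s σ) := by
  have hat := atRecord_run_loadProg henv htable hc haddr hcount
  refine ((HaltsWithin.of_loopFree (Q := (· = loadProg.run σ)) rfl rfl).seq (R := Visited n K d s σ)
    (T' := 7 * n + 32 * K + 40) ?_).of_le (by simp only [Prog.cost, Prog.block, loadProg]; omega)
  rintro _ rfl
  refine ((haltsWithin_expandProg hat hd).seq fun τ ⟨hτ, hclosed⟩ =>
    .of_loopFree rfl ?_).of_le (by simp only [Prog.cost]; omega)
  have hle : s.done ≤ n := (Nat.le_add_right _ _).trans hat.valid.card_le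
  have hgoal : τ.reg rGoal = σ.reg rGoal := hτ.reg rGoal (by decide)
  have hsweep : τ.reg rSweep = σ.reg rSweep := hτ.reg rSweep (by decide)
  obtain ⟨henv', htable', -, haddr', -, -, hdone', -⟩ := hτ.atRecord
  rcases hle.eq_or_lt with heq | hlt
  · simp only [Prog.run, henv'.reg_n, hdone', heq, State.reg_setReg, Nat.sub_self, ↓reduceIte]
    refine ⟨henv'.congr fun x hx => ?_, htable', hτ.grows, hclosed, hsweep, ?_⟩
    · simp [show x ≠ rGoal by omega, show x ≠ rTest by omega]
    · simp [heq, haddr']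
  · simp only [Prog.run, henv'.reg_n, hdone', State.reg_setReg, Nat.sub_ne_zero_of_lt hlt,
      ↓reduceIte]
    refine ⟨henv'.congr fun x hx => ?_, htable', hτ.grows, hclosed, hsweep, ?_⟩
    · simp [show x ≠ rTest by omega]
    · simp [hlt.ne, hgoal]

/-- The records with numbers at least `x` have been visited. -/
structure Swept (n K : ℕ) (d : List ℕ) (x : ℕ) (σ : State) : Prop where
  env : Env n K σ.reg
  table : Table n K d σ.mem
  reg_sweep : σ.reg rSweep = 8 * x
  closed : ∀ s, s.Valid n K → x ≤ index n K s → σ.mem (addr n K s) ≠ 0 → Closed n K d σ.mem s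
  goal_ne_zero : ∀ s, s.Valid n K → x ≤ index n K s → σ.mem (addr n K s) ≠ 0 → s.done = n →
    σ.reg rGoal ≠ 0
  exists_goal : σ.reg rGoal ≠ 0 →
    ∃ j s, Chain n K d σ.mem j s ∧ s.done = n ∧ σ.reg rGoal = addr n K s

/-- Visit the next record, if it is used. -/
def sweepBody : Prog :=
  .seq (.block [.sub rSweep rSweep rEight, .add rAddr rTable rSweep, .load rCount rAddr])
    (.branch rCount visitProg .skip)

theorem addr_ne_zero (hs : s.Valid n K) : addr n K s ≠ 0 := by
  have := hs.card_le
  have := hs.card_pos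
  unfold addr cell
  omega

theorem Swept.of_visited {x : ℕ} (h : Swept n K d (x + 1) σ) (hs : s.Valid n K)
    (hx : index n K s = x) (hmem : σ'.mem = σ.mem) (hsweep : σ'.reg rSweep = 8 * x)
    (hgoal : σ'.reg rGoal = σ.reg rGoal) (hc : Chain n K d σ.mem j s)
    (hv : Visited n K d s σ' σ'') : Swept n K d x σ'' := by
  obtain ⟨henv, htable, hgrows, hclosed, hsweep', hgoal'⟩ := hv
  rw [hmem] at hgrows
  rw [hgoal] at hgoal'
  have hcase : ∀ t, t.Valid n K → x ≤ index n K t → σ''.mem (addr n K t) ≠ 0 →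
      t = s ∨ x + 1 ≤ index n K t ∧ σ.mem (addr n K t) ≠ 0 := fun t ht hle hm => by
    rcases hle.eq_or_lt with heq | hlt
    · exact .inl (ht.index_injOn hs (heq.symm.trans hx.symm))
    · exact .inr ⟨hlt, hgrows.mark _ (hx.trans_le hle) ▸ hm⟩
  refine ⟨henv, htable, hsweep'.trans hsweep, fun t ht hle hm => ?_, fun t ht hle hm hn => ?_,
    fun hne => ?_⟩
  · obtain rfl | ⟨hlt, hm'⟩ := hcase t ht hle hm
    · exact hclosed
    · exact (h.closed t ht hlt hm').grows hgrows
  · rw [hgoal']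
    split_ifs with hfin
    · exact addr_ne_zero hs
    · obtain rfl | ⟨hlt, hm'⟩ := hcase t ht hle hm
      · exact absurd hn hfin
      · exact h.goal_ne_zero t ht hlt hm' hn
  · rw [hgoal'] at hne ⊢
    split_ifs at hne ⊢ with hfin
    · exact ⟨j, s, hc.grows hgrows, hfin, rfl⟩
    · obtain ⟨i, t, ht, hn, hgoal⟩ := h.exists_goal hne
      exact ⟨i, t, ht.grows hgrows, hn, hgoal⟩

theorem Swept.of_unused {x : ℕ} (h : Swept n K d (x + 1) σ) (hx : σ.mem (cell n K x) = 0)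
    (henv : Env n K σ'.reg) (hmem : σ'.mem = σ.mem) (hsweep : σ'.reg rSweep = 8 * x)
    (hgoal : σ'.reg rGoal = σ.reg rGoal) : Swept n K d x σ' := by
  have hlt : ∀ t, x ≤ index n K t → σ.mem (addr n K t) ≠ 0 → x + 1 ≤ index n K t :=
    fun t hle hm => Nat.lt_of_le_of_ne hle fun heq => hm (by rw [addr, ← heq, hx])
  refine ⟨henv, ?_, hsweep, ?_, ?_, ?_⟩ <;> simp only [hmem, hgoal]
  · exact h.table
  · exact fun t ht hle hm => h.closed t ht (hlt t hle hm) hm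
  · exact fun t ht hle hm => h.goal_ne_zero t ht (hlt t hle hm) hm
  · exact h.exists_goal

theorem haltsWithin_sweepBody {x : ℕ} (h : Swept n K d (x + 1) σ) (hd : d.length = n) :
    HaltsWithin sweepBody σ (7 * n + 32 * K + 52) (Swept n K d x) := by
  refine ((HaltsWithin.of_loopFree (Q := fun σ' => σ'.mem = σ.mem ∧ σ'.reg rSweep = 8 * x ∧
    σ'.reg rAddr = cell n K x ∧ σ'.reg rCount = σ.mem (cell n K x)) rfl ?_).and_reg_eq.seq
      (T' := 1 + (7 * n + 32 * K + 47)) fun τ ⟨⟨hmem, hsweep, haddr, hcount⟩, hreg⟩ => ?_).of_le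
        (by simp only [Prog.cost, Prog.block]; omega)
  · simp [h.reg_sweep, h.env.reg_eight, h.env.reg_table, cell, Nat.mul_succ]
  have henv : Env n K τ.reg := h.env.congr fun r hr => hreg r (by
    simp only [Prog.block, Prog.targets, List.cons_append, List.nil_append, List.append_nil,
      List.mem_cons, List.not_mem_nil, or_false]
    omega)
  have hgoal : τ.reg rGoal = σ.reg rGoal := hreg _ (by decide)
  refine .branch (fun hne => ?_) fun heq => (HaltsWithin.of_loopFree (P := .skip) rfl
    (h.of_unused (hcount ▸ heq) henv hmem hsweep hgoal)).of_le (by simp only [Prog.cost]; omega)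
  obtain ⟨j, s, hc, hx⟩ := h.table.chain x (hcount ▸ hne)
  refine (haltsWithin_visitProg henv (hmem ▸ h.table) (hmem ▸ hc) ?_ ?_ hd).imp fun _ hv =>
    h.of_visited hc.valid hx hmem hsweep hgoal hc hv
  · rw [haddr, addr, hx]
  · rw [hcount, addr, hx, hmem]

/-- Visit all records, by decreasing number. -/
def sweepProg : Prog := .loop rSweep sweepBody

theorem haltsWithin_sweepProg (henv : Env n K σ.reg) (htable : Table n K d σ.mem)
    (hsweep : σ.reg rSweep = 8 * tableSize n K) (hgoal : σ.reg rGoal = 0) (hd : d.length = n) :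
    HaltsWithin sweepProg σ (tableSize n K * (7 * n + 32 * K + 53) + 1) (Swept n K d 0) := by
  refine HaltsWithin.loop (I := Swept n K d) (fun _ h => h.reg_sweep) (fun j τ h => ⟨?_,
    haltsWithin_sweepBody h hd⟩) (tableSize n K) σ ⟨henv, htable, hsweep, ?_, ?_, ?_⟩
  · rw [h.reg_sweep]
    omega
  · exact fun s hs hle => absurd hs.index_lt hle.not_gt
  · exact fun s hs hle => absurd hs.index_lt hle.not_gt
  · exact fun hne => absurd hgoal hne

theorem Swept.goal_ne_zero_of_reachable (h : Swept n K d 0 σ) (hn : 0 < n)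
    (hs : Relation.ReflTransGen (fun s s' => ∃ mv, Step n K d mv s s') start s)
    (hdone : s.done = n) : σ.reg rGoal ≠ 0 := by
  have hreach : s.Valid n K ∧ σ.mem (addr n K s) ≠ 0 := by
    clear hdone
    induction hs with
    | refl => exact ⟨valid_start hn, h.table.start⟩
    | tail _ hstep ih =>
      obtain ⟨mv, hstep⟩ := hstep
      exact ⟨hstep.valid ih.1, h.closed _ ih.1 (Nat.zero_le _) ih.2 mv _ hstep⟩
  exact h.goal_ne_zero s hreach.1 (Nat.zero_le _) hreach.2 hdone

end Steps

end Conf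

/-! ### Building the tree -/

namespace RAM

/-- A tree of a forest that is stored in the memory: the depth `lev` at which it is to be attached,
the address of its root, and the cells that it occupies. The cell `root + 4` is not among them; it
holds the link to the next tree with the same `lev`. -/
structure Entry where
  lev : ℕ
  tree : LTree
  root : ℕ
  cells : Finset ℕ

/-- The cells of an entry, including its link. -/
def Entry.block (e : Entry) : Finset ℕ := insert (e.root + 4) e.cells

/-- The trees of the entries in `Z` are stored disjointly in the cells `lo, …, hi - 1`. -/
structure Packed (lo hi : ℕ) (m : ℕ → ℕ) (Z : List Entry) : Prop where
  le : lo ≤ hi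
  stored : ∀ e ∈ Z, Stored m e.tree e.root e.cells
  link_notMem : ∀ e ∈ Z, e.root + 4 ∉ e.cells
  disjoint : Z.Pairwise fun e e' => Disjoint e.block e'.block
  range : ∀ e ∈ Z, ∀ q ∈ e.block, lo ≤ q ∧ q < hi

/-- The addresses in `L` form a linked list with first address `p`, the link of `q` being the
content of the cell `q + 4`. No condition is imposed on the link of the last address. -/
def Linked (m : ℕ → ℕ) : ℕ → List ℕ → Prop
  | _, [] => True
  | p, q :: L => p = q ∧ Linked m (m (q + 4)) L

/-- The entries in `Y` and `X` are stored at the addresses `2 * h, …, f - 1`, and those entries in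
`X` that have the same level `l < h` form a linked list whose first address is in the cell
`h + l`. -/
structure Heap (h f : ℕ) (m : ℕ → ℕ) (Y X : List Entry) : Prop where
  packed : Packed (2 * h) f m (Y ++ X)
  linked : ∀ l < h, Linked m (m (h + l)) ((X.filter (·.lev = l)).map Entry.root)

variable {m m' : ℕ → ℕ} {lo hi h f p l a b : ℕ} {L : List ℕ} {X Y Z Z' : List Entry} {e e' : Entry}

theorem Stored.congr {T : LTree} {S : Finset ℕ} (h : Stored m T p S)
    (hm : ∀ q ∈ S, m' q = m q) : Stored m' T p S := by
  induction h with
  | leaf hp => exact .leaf ((hm _ (by simp)).trans hp)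
  | @node p l r S₁ S₂ hp _ _ h₁₂ h₁ h₂ ihl ihr =>
    have h0 : m' p = m p := hm p (by simp)
    have h1 : m' (p + 1) = m (p + 1) := hm _ (by simp)
    have h2 : m' (p + 2) = m (p + 2) := hm _ (by simp)
    have h3 : m' (p + 3) = m (p + 3) := hm _ (by simp)
    have hl := ihl fun q hq => hm q (by simp [hq])
    have hr := ihr fun q hq => hm q (by simp [hq])
    rw [← h0, ← h1]
    exact .node (h0 ▸ hp) (h2 ▸ hl) (h3 ▸ hr) h₁₂ h₁ h₂

theorem Linked.congr (h : Linked m p L) (hm : ∀ q ∈ L, m' (q + 4) = m (q + 4)) :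
    Linked m' p L := by
  induction L generalizing p with
  | nil => trivial
  | cons q L ih =>
    rw [List.forall_mem_cons] at hm
    exact ⟨h.1, hm.1 ▸ ih h.2 hm.2⟩

namespace Packed

theorem congr (h : Packed lo hi m Z) (hm : ∀ e ∈ Z, ∀ q ∈ e.cells, m' q = m q) :
    Packed lo hi m' Z :=
  { h with stored := fun e he => (h.stored e he).congr (hm e he) }

theorem congr_Ico (h : Packed lo hi m Z) (hm : ∀ q, lo ≤ q → q < hi → m' q = m q) :
    Packed lo hi m' Z :=
  h.congr fun e he q hq =>
    have hq := h.range e he q (Finset.mem_insert_of_mem hq)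
    hm q hq.1 hq.2

theorem perm (h : Packed lo hi m Z) (hZ : Z.Perm Z') : Packed lo hi m Z' := by
  obtain ⟨hle, hstored, hlink, hdisj, hrange⟩ := h
  simp only [hZ.mem_iff] at hstored hlink hrange
  exact ⟨hle, hstored, hlink, (hZ.pairwise_iff fun h => h.symm).1 hdisj, hrange⟩

theorem cons {hi' : ℕ} (h : Packed lo hi m Z) (hle : hi ≤ hi')
    (hs : Stored m e.tree e.root e.cells) (hlink : e.root + 4 ∉ e.cells)
    (hr : ∀ q ∈ e.block, lo ≤ q ∧ q < hi')
    (hnew : ∀ q ∈ e.block, hi ≤ q ∨ ∀ x ∈ Z, q ∉ x.block) : Packed lo hi' m (e :: Z) := by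
  refine ⟨h.le.trans hle, List.forall_mem_cons.2 ⟨hs, h.stored⟩,
    List.forall_mem_cons.2 ⟨hlink, h.link_notMem⟩,
    List.pairwise_cons.2 ⟨fun x hx => Finset.disjoint_left.2 fun q hq hqx => ?_, h.disjoint⟩,
    List.forall_mem_cons.2 ⟨hr, fun x hx q hq => ?_⟩⟩
  · exact (hnew q hq).elim (fun hq => (h.range x hx q hqx).2.not_ge hq) fun hq => hq x hx hqx
  · exact ⟨(h.range x hx q hq).1, (h.range x hx q hq).2.trans_le hle⟩

theorem cons_leaf (h : Packed lo f m Z) (hm : ∀ q, lo ≤ q → q < f → m' q = m q)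
    (hf : m' f = 0) : Packed lo (f + 8) m' (⟨l, .leaf, f, {f}⟩ :: Z) := by
  have hle := h.le
  refine (h.congr_Ico hm).cons (by omega) (.leaf hf) (by simp) (fun q hq => ?_) fun q hq => ?_ <;>
    simp only [Entry.block, Finset.mem_insert, Finset.mem_singleton] at hq <;> omega

theorem stored_node (h : Packed lo f m (e :: e' :: Z)) (ha : m f ≠ 0)
    (h2 : m (f + 2) = e.root) (h3 : m (f + 3) = e'.root) :
    Stored m (.node (m f) (m (f + 1)) e.tree e'.tree) f
      ({f, f + 1, f + 2, f + 3} ∪ e.cells ∪ e'.cells) := by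
  have hnew : ∀ x ∈ e :: e' :: Z, Disjoint {f, f + 1, f + 2, f + 3} x.cells := fun x hx =>
    Finset.disjoint_left.2 fun q hq hqx => by
      have := h.range x hx q (Finset.mem_insert_of_mem hqx)
      simp only [Finset.mem_insert, Finset.mem_singleton] at hq
      omega
  have hs := h.stored e (by simp)
  have hs' := h.stored e' (by simp)
  rw [← h2] at hs
  rw [← h3] at hs'
  exact .node ha hs hs' ((List.rel_of_pairwise_cons h.disjoint (by simp)).mono
    (Finset.subset_insert _ _) (Finset.subset_insert _ _)) (hnew e (by simp)) (hnew e' (by simp))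

theorem cons_node (h : Packed lo f m (e :: e' :: Z)) (ha : a ≠ 0)
    (hm : ∀ q, lo ≤ q → q < f → m' q = m q) (h0 : m' f = a) (h1 : m' (f + 1) = b)
    (h2 : m' (f + 2) = e.root) (h3 : m' (f + 3) = e'.root) :
    Packed lo (f + 8) m' (⟨l, .node a b e.tree e'.tree, f,
      {f, f + 1, f + 2, f + 3} ∪ e.cells ∪ e'.cells⟩ :: Z) := by
  subst h0 h1
  have hnode := (h.congr_Ico hm).stored_node ha h2 h3
  obtain ⟨hle, hstored, hlink, hdisj, hrange⟩ := h.congr_Ico hm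
  simp only [List.forall_mem_cons, List.pairwise_cons] at hstored hlink hdisj hrange
  obtain ⟨⟨-, heZ⟩, heZ', hdisj⟩ := hdisj
  obtain ⟨hr, hr', hrange⟩ := hrange
  have hcells : ∀ q ∈ e.cells ∪ e'.cells, lo ≤ q ∧ q < f ∧ ∀ x ∈ Z, q ∉ x.block := by
    have hsub : ∀ {x : Entry} {q : ℕ}, q ∈ x.cells → q ∈ x.block := Finset.mem_insert_of_mem
    intro q hq
    rcases Finset.mem_union.1 hq with hq | hq
    · exact ⟨(hr q (hsub hq)).1, (hr q (hsub hq)).2, fun x hx =>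
        Finset.disjoint_left.1 (heZ x hx) (hsub hq)⟩
    · exact ⟨(hr' q (hsub hq)).1, (hr' q (hsub hq)).2, fun x hx =>
        Finset.disjoint_left.1 (heZ' x hx) (hsub hq)⟩
  refine cons ⟨hle, hstored.2.2, hlink.2.2, hdisj, hrange⟩ (by omega) hnode (fun hq => ?_)
    (fun q hq => ?_) fun q hq => ?_
  · have : f + 4 ∈ e.cells ∪ e'.cells := by simpa [Finset.union_assoc] using hq
    exact absurd (hcells _ this) (by omega)
  all_goals
    simp only [Entry.block, Finset.union_assoc, Finset.mem_insert,
      Finset.mem_union (s := {f, f + 1, f + 2, f + 3}), Finset.mem_singleton] at hq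
    grind

end Packed

namespace Heap

theorem head_lt (H : Heap h f m Y X) (he : e ∈ Y ++ X) (hl : l < h) {q : ℕ} (hq : q ∈ e.block) :
    h + l < q := by
  have := (H.packed.range e he q hq).1
  omega

theorem nil (h : ℕ) (m : ℕ → ℕ) : Heap h (2 * h) m [] [] :=
  ⟨⟨le_rfl, by simp, by simp, by simp, by simp⟩, fun _ _ => trivial⟩

theorem linked_update_head (H : Heap h f m Y X) (hl : l < h) (hL : L ⊆ X.map Entry.root)
    (v : ℕ) (h' : Linked m p L) : Linked (Function.update m (h + l) v) p L :=
  h'.congr fun q hq => by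
    obtain ⟨e, he, rfl⟩ := List.mem_map.1 (hL hq)
    have := H.head_lt (List.mem_append_right Y he) hl (Finset.mem_insert_self _ _)
    exact Function.update_of_ne (by omega) _ _

theorem pop (H : Heap h f m Y X) (hl : l < h) (hX : ∃ e ∈ X, e.lev = l) :
    ∃ e X', e.lev = l ∧ X.Perm (e :: X') ∧ m (h + l) = e.root ∧
      Heap h f (Function.update m (h + l) (m (e.root + 4))) (e :: Y) X' := by
  obtain ⟨e, L, hL⟩ : ∃ e L, X.filter (·.lev = l) = e :: L := by
    obtain ⟨e, he, hle⟩ := hX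
    exact List.exists_cons_of_ne_nil (List.ne_nil_of_mem (List.mem_filter.2 ⟨he, by simpa⟩))
  have hlinked := H.linked l hl
  rw [hL] at hlinked
  obtain ⟨X₁, X₂, rfl, hX₁, hle, rfl⟩ := List.filter_eq_cons_iff.1 hL
  simp only [decide_eq_true_eq] at hX₁ hle
  have hperm : (X₁ ++ e :: X₂).Perm (e :: (X₁ ++ X₂)) := List.perm_middle
  refine ⟨e, X₁ ++ X₂, hle, hperm, hlinked.1, ?_, fun l' hl' => ?_⟩
  · refine (H.packed.perm (((List.Perm.refl Y).append hperm).trans List.perm_middle)).congr_Ico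
      fun q hq _ => Function.update_of_ne (by omega) _ _
  · have hsub : ((X₁ ++ X₂).filter (·.lev = l')).map Entry.root ⊆
        (X₁ ++ e :: X₂).map Entry.root := List.map_subset _ fun x hx =>
      hperm.mem_iff.2 (List.mem_cons_of_mem e (List.mem_filter.1 hx).1)
    refine linked_update_head H hl hsub _ ?_
    by_cases hll : l' = l
    · have hnil : X₁.filter (·.lev = l) = [] := List.filter_eq_nil_iff.2 (by simpa using hX₁)
      subst hll
      simpa [List.filter_append, hnil] using hlinked.2
    · have hne : e.lev ≠ l' := hle.trans_ne (Ne.symm hll)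
      simpa [hll, List.filter_append, List.filter_cons, hne] using H.linked l' hl'

theorem push (H : Heap h f m (e :: Y) X) (hl : e.lev < h) :
    Heap h f (Function.update (Function.update m (e.root + 4) (m (h + e.lev))) (h + e.lev) e.root)
      Y (e :: X) := by
  have hhead : h + e.lev < e.root + 4 := H.head_lt (by simp) hl (Finset.mem_insert_self _ _)
  have hdisj : ∀ x ∈ Y ++ X, e.root + 4 ∉ x.block := fun x hx =>
    Finset.disjoint_left.1 ((List.pairwise_cons.1 H.packed.disjoint).1 x hx)
      (Finset.mem_insert_self _ _)
  refine ⟨(H.packed.perm List.perm_middle.symm).congr fun x hx q hq => ?_, fun l' hl' => ?_⟩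
  · have hx' : x ∈ e :: Y ++ X := List.perm_middle.mem_iff.1 hx
    have hne : q ≠ h + e.lev := (H.head_lt hx' hl (Finset.mem_insert_of_mem hq)).ne'
    rw [Function.update_of_ne hne, Function.update_of_ne]
    rcases List.mem_cons.1 hx' with rfl | hx'
    · exact ne_of_mem_of_not_mem hq (H.packed.link_notMem _ (by simp))
    · exact ne_of_mem_of_not_mem (Finset.mem_insert_of_mem hq) (hdisj x hx')
  · have hcongr : ∀ v w p, Linked m p ((X.filter (·.lev = l')).map Entry.root) →
        Linked (Function.update (Function.update m (e.root + 4) v) (h + e.lev) w) p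
          ((X.filter (·.lev = l')).map Entry.root) := fun v w p hL => hL.congr fun q hq => by
      obtain ⟨x, hx, rfl⟩ := List.mem_map.1 hq
      have hx' : x ∈ Y ++ X := List.mem_append_right Y (List.mem_filter.1 hx).1
      have hmem : x.root + 4 ∈ x.block := Finset.mem_insert_self _ _
      have hne : x.root + 4 ≠ h + e.lev := (H.head_lt (List.mem_cons_of_mem e hx') hl hmem).ne'
      rw [Function.update_of_ne hne,
        Function.update_of_ne (ne_of_mem_of_not_mem hmem (hdisj x hx'))]
    by_cases hll : e.lev = l'
    · subst hll
      simpa [Linked, hhead.ne'] using hcongr _ _ _ (H.linked _ hl)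
    · have hne : h + l' ≠ e.root + 4 :=
        (H.head_lt (by simp) hl' (Finset.mem_insert_self _ _)).ne
      simpa [hll, hne, Ne.symm hll] using hcongr _ _ _ (H.linked l' hl')

theorem of_packed {f' : ℕ} {Y' : List Entry} (H : Heap h f m Y X) (hm : ∀ q < f, m' q = m q)
    (hp : Packed (2 * h) f' m' (Y' ++ X)) : Heap h f' m' Y' X := by
  refine ⟨hp, fun l hl => ?_⟩
  have hle := H.packed.le
  rw [hm _ (by omega)]
  refine (H.linked l hl).congr fun q hq => ?_
  obtain ⟨x, hx, rfl⟩ := List.mem_map.1 hq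
  exact hm _ (H.packed.range x (List.mem_append_right Y (List.mem_filter.1 hx).1) _
    (Finset.mem_insert_self _ _)).2

theorem leaf (H : Heap h f m Y X) (l : ℕ) :
    Heap h (f + 8) (Function.update m f 0) (⟨l, .leaf, f, {f}⟩ :: Y) X :=
  have hm : ∀ q < f, Function.update m f 0 q = m q := fun _ hq => Function.update_of_ne hq.ne _ _
  H.of_packed hm (H.packed.cons_leaf (fun q _ => hm q) (Function.update_self _ _ _))

theorem node (H : Heap h f m (e :: e' :: Y) X) (ha : a ≠ 0) (hm : ∀ q < f, m' q = m q)
    (h0 : m' f = a) (h1 : m' (f + 1) = b) (h2 : m' (f + 2) = e.root) (h3 : m' (f + 3) = e'.root) :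
    Heap h (f + 8) m' (⟨l, .node a b e.tree e'.tree, f,
      {f, f + 1, f + 2, f + 3} ∪ e.cells ∪ e'.cells⟩ :: Y) X :=
  H.of_packed hm (H.packed.cons_node ha (fun q _ => hm q) h0 h1 h2 h3)

end Heap

end RAM

namespace Conf

open RAM

variable {n K l i j a b mv : ℕ} {D M : Multiset ℕ} {d : List ℕ} {s s' : Conf} {m : ℕ → ℕ}
  {X Y : List Entry} {e e' : Entry} {σ σ' : State} {P : Prog}

theorem Env.run (h : Env n K σ.reg) (hP : P.loopFree = true) (ht : ∀ r ∈ P.targets, rGoal ≤ r) :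
    Env n K (P.run σ).reg :=
  h.congr fun r hr => Prog.reg_run_of_notMem_targets hP (fun hmem => (ht r hmem).not_gt hr) σ

/-- The forest formed by the trees of the entries in `X`. -/
def forest (X : List Entry) : Multiset (ℕ × LTree) :=
  (X : Multiset Entry).map fun e => (e.lev, e.tree)

theorem forest_cons : forest (e :: X) = (e.lev, e.tree) ::ₘ forest X := rfl

theorem forest_congr (h : X.Perm Y) : forest X = forest Y := by
  rw [forest, Multiset.coe_eq_coe.2 h, forest]

/-- The machine holds the trees in `Y` and `X`, those in `X` being accessible by their level, and
the table in `m` is still intact. -/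
structure Holds (n K : ℕ) (m : ℕ → ℕ) (Y X : List Entry) (σ : State) : Prop where
  env : Env n K σ.reg
  mem : ∀ q < tableEnd n K, σ.mem q = m q
  heap : Heap (tableEnd n K) (σ.reg rFree) σ.mem Y X

theorem Holds.run (h : Holds n K m Y X σ) (hP : P.loopFree = true) (hst : P.storeFree = true)
    (ht : ∀ r ∈ P.targets, rGoal ≤ r ∧ r ≠ rFree) : Holds n K m Y X (P.run σ) := by
  have hmem := Prog.mem_run_of_storeFree hP hst σ
  have hfree := Prog.reg_run_of_notMem_targets hP (fun hr => (ht rFree hr).2 rfl) σ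
  exact ⟨h.env.run hP fun r hr => (ht r hr).1, hmem ▸ h.mem, by rw [hmem, hfree]; exact h.heap⟩

/-- Remove a tree from the list for the level `rSlot`. -/
def popProg : Prog :=
  .block [.add rPtr rEnd rSlot, .load rNode rPtr, .const rTmp 4, .add rTmp rNode rTmp,
    .load rTmp rTmp, .store rPtr rTmp]

/-- Add the tree with the root `rNode` to the list for the level `rSlot`. -/
def pushProg : Prog :=
  .block [.add rPtr rEnd rSlot, .const rTmp 4, .add rTmp rNode rTmp, .load rAcc rPtr,
    .store rTmp rAcc, .store rPtr rNode]

theorem Holds.run_popProg (h : Holds n K m Y X σ) (hl : σ.reg rSlot < tableEnd n K)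
    (hX : σ.reg rSlot ∈ (forest X).map Prod.fst) : ∃ e X', e.lev = σ.reg rSlot ∧
      forest X = forest (e :: X') ∧ (popProg.run σ).reg rNode = e.root ∧
        Holds n K m (e :: Y) X' (popProg.run σ) := by
  obtain ⟨e, X', hle, hperm, hroot, hheap⟩ := h.heap.pop hl (by simpa [forest] using hX)
  have hmem : (popProg.run σ).mem = Function.update σ.mem (tableEnd n K + σ.reg rSlot)
      (σ.mem (e.root + 4)) := by
    simp [popProg, h.env.reg_end, hroot]
  refine ⟨e, X', hle, forest_congr hperm, by simp [popProg, h.env.reg_end, hroot],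
    h.env.run rfl (by decide), fun q hq => ?_, ?_⟩
  · rw [hmem, Function.update_of_ne (by omega), h.mem q hq]
  · rw [hmem]
    exact hheap

theorem Holds.run_pushProg (h : Holds n K m (e :: Y) X σ) (hl : σ.reg rSlot < tableEnd n K)
    (hle : e.lev = σ.reg rSlot) (hroot : e.root = σ.reg rNode) :
    Holds n K m Y (e :: X) (pushProg.run σ) := by
  have hlt : tableEnd n K + e.lev < e.root + 4 :=
    h.heap.head_lt (by simp) (hle ▸ hl) (Finset.mem_insert_self _ _)
  have hmem : (pushProg.run σ).mem = Function.update (Function.update σ.mem (e.root + 4)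
      (σ.mem (tableEnd n K + e.lev))) (tableEnd n K + e.lev) e.root := by
    simp [pushProg, h.env.reg_end, hroot, hle]
  refine ⟨h.env.run rfl (by decide), fun q hq => ?_, ?_⟩
  · rw [hmem, Function.update_of_ne (by omega), Function.update_of_ne (by omega), h.mem q hq]
  · rw [hmem]
    exact h.heap.push (hle ▸ hl)

/-- Build a leaf at the level `rLev`. -/
def buildLeaf : Prog :=
  .seq (.block [.const rTmp 0, .store rFree rTmp, .copy rNode rFree, .add rFree rFree rEight,
    .copy rSlot rLev]) pushProg

theorem Holds.run_buildLeaf (h : Holds n K m Y X σ) (hl : σ.reg rLev < tableEnd n K) :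
    ∃ e, (e.lev, e.tree) = (σ.reg rLev, .leaf) ∧ Holds n K m Y (e :: X) (buildLeaf.run σ) := by
  have hle := h.heap.packed.le
  refine ⟨⟨σ.reg rLev, .leaf, σ.reg rFree, {σ.reg rFree}⟩, rfl, ?_⟩
  refine Holds.run_pushProg ⟨h.env.run rfl (by decide), fun q hq => ?_, ?_⟩ ?_ ?_ ?_
  · simpa using (Function.update_of_ne (by omega) _ _).trans (h.mem q hq)
  · simpa [h.env.reg_eight] using h.heap.leaf (σ.reg rLev)
  all_goals simp [hl]

/-- Join the trees with the roots `rNode` and `rRight` by a new vertex at the level `rLev`. -/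
def joinProg : Prog :=
  .block [.store rFree rMove, .add rTmp rDelta rOne, .sub rTmp rTmp rMove,
    .add rPtr rFree rOne, .store rPtr rTmp, .add rPtr rPtr rOne, .store rPtr rNode,
    .add rPtr rPtr rOne, .store rPtr rRight, .copy rNode rFree, .add rFree rFree rEight,
    .copy rSlot rLev]

theorem Holds.run_joinProg (h : Holds n K m (e :: e' :: Y) X σ) (ha : 1 ≤ a)
    (hab : a + b = K + 1) (hmv : σ.reg rMove = a) (hroot : σ.reg rNode = e.root)
    (hroot' : σ.reg rRight = e'.root) : ∃ S, Holds n K m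
      (⟨σ.reg rLev, .node a b e.tree e'.tree, σ.reg rFree, S⟩ :: Y) X (joinProg.run σ) := by
  have hle := h.heap.packed.le
  have hb : K + 1 - a = b := by omega
  have hmem : (joinProg.run σ).mem = Function.update (Function.update (Function.update
      (Function.update σ.mem (σ.reg rFree) a) (σ.reg rFree + 1) b) (σ.reg rFree + 2) e.root)
        (σ.reg rFree + 3) e'.root := by
    simp [joinProg, h.env.reg_one, h.env.reg_delta, hmv, hroot, hroot', hb, add_assoc]
  have hlt : ∀ q < σ.reg rFree, (joinProg.run σ).mem q = σ.mem q := fun q hq => by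
    rw [hmem]
    iterate 4 rw [Function.update_of_ne (by omega)]
  have hfree : (joinProg.run σ).reg rFree = σ.reg rFree + 8 := by
    simp [joinProg, h.env.reg_eight]
  have hheap := h.heap.node (l := σ.reg rLev) (by omega) hlt (a := a) (b := b) (by simp [hmem])
    (by simp [hmem]) (by simp [hmem]) (by simp [hmem])
  exact ⟨_, h.env.run rfl (by decide), fun q hq => (hlt q (by omega)).trans (h.mem q hq),
    hfree ▸ hheap⟩

/-- Prepare the removal of the second child of the vertex to be built. -/
def selectRight : Prog :=
  .block [.add rSlot rLev rDelta, .add rSlot rSlot rOne, .sub rSlot rSlot rMove]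

/-- Keep the second child, and prepare the removal of the first one. -/
def selectLeft : Prog :=
  .block [.copy rRight rNode, .add rSlot rLev rMove]

/-- Build an internal vertex at the level `rLev`, the length of its first edge being `rMove`. -/
def buildNode : Prog :=
  .block [selectRight, popProg, selectLeft, popProg, joinProg, pushProg]

theorem Holds.run_buildNode (h : Holds n K m Y X σ) (hl : σ.reg rLev + K < tableEnd n K)
    (ha : 1 ≤ a) (hb : 1 ≤ b) (hab : a + b = K + 1) (hmv : σ.reg rMove = a)
    (hX : (forest X).map Prod.fst = (σ.reg rLev + a) ::ₘ (σ.reg rLev + b) ::ₘ M) :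
    ∃ T T' F X', forest X = (σ.reg rLev + a, T) ::ₘ (σ.reg rLev + b, T') ::ₘ F ∧
      forest X' = (σ.reg rLev, .node a b T T') ::ₘ F ∧
        Holds n K m Y X' (buildNode.run σ) := by
  have hslot₁ : (selectRight.run σ).reg rSlot = σ.reg rLev + b := by
    have hsub : σ.reg rLev + K + 1 - a = σ.reg rLev + b := by omega
    simpa [selectRight, h.env.reg_delta, h.env.reg_one, hmv] using hsub
  obtain ⟨e', X₁, hlev', hX₁, hroot', h₁⟩ := (h.run (P := selectRight) rfl rfl
    (by decide)).run_popProg (by omega) (by simp [hslot₁, hX])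
  rw [forest_cons, hlev', hslot₁] at hX₁
  rw [hX₁, Multiset.map_cons, Multiset.cons_swap, Multiset.cons_inj_right] at hX
  have hslot₂ : (selectLeft.run (popProg.run (selectRight.run σ))).reg rSlot = σ.reg rLev + a := by
    simp [selectLeft, popProg, selectRight, hmv]
  obtain ⟨e, X₂, hlev, hX₂, hroot, h₂⟩ := (h₁.run (P := selectLeft) rfl rfl
    (by decide)).run_popProg (by omega) (by simp [hslot₂, hX])
  rw [forest_cons, hlev, hslot₂] at hX₂
  obtain ⟨S, h₃⟩ := h₂.run_joinProg ha hab (by simp [selectLeft, popProg, selectRight, hmv]) hroot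
    (by simpa [selectLeft, popProg] using hroot')
  refine ⟨e.tree, e'.tree, forest X₂, _, ?_, ?_, h₃.run_pushProg ?_ ?_ ?_⟩
  · rw [hX₁, hX₂, Multiset.cons_swap]
  · simp [forest_cons, selectLeft, popProg, selectRight]
  all_goals simp [joinProg, selectLeft, popProg, selectRight]
  omega

theorem Valid.lev_add_lt_tableEnd (h : s.Valid n K) : s.lev + K < tableEnd n K := by
  have := h.lev_le
  have := h.card_le
  have := h.card_pos
  have : K * n + 1 ≤ tableSize n K :=
    (Nat.le_mul_of_pos_left _ n.succ_pos).trans (Nat.le_mul_of_pos_left _ (by positivity))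
  unfold tableEnd cell
  omega

/-- Undo the step `rMove` that has led to the current configuration, whose level is `rLev`. -/
def undoProg : Prog :=
  .branch rMove (.seq (.block [.add rTest rDelta rOne, .sub rTest rTest rMove])
    (.branch rTest buildNode buildLeaf)) .skip

theorem Holds.run_undoProg (h : Holds n K m Y X σ) (hs : Step n K D mv s s')
    (hv : s'.Valid n K) (hmv : σ.reg rMove = mv) (hlev : σ.reg rLev = s'.lev)
    (hF : Completes K D s' (forest X)) :
    ∃ X', Holds n K m Y X' (undoProg.run σ) ∧ Completes K D s (forest X') := by
  have hlt := hv.lev_add_lt_tableEnd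
  rw [← hlev] at hlt
  have h' := h.run (P := .block [.add rTest rDelta rOne, .sub rTest rTest rMove]) rfl rfl
    (by decide)
  cases hs with
  | shift hl hM => exact ⟨X, by simpa [undoProg, hmv] using h, completes_shift_iff.1 hF⟩
  | @leaf l i M hD =>
    obtain ⟨e, he, hh⟩ := h'.run_buildLeaf (by simp; omega)
    refine ⟨e :: X, by simpa [undoProg, hmv, h.env.reg_delta, h.env.reg_one] using hh, ?_⟩
    rw [forest_cons, he]
    simpa [hlev] using hF.leaf hD
  | @split _ b l i M ha hb hab hn =>
    have hleft : mv ≠ 0 := by omega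
    have hright : K + 1 - mv ≠ 0 := by omega
    obtain ⟨T, T', F, X', hX, hX', hh⟩ := h'.run_buildNode (M := M) (by simpa using hlt) ha hb hab
      (by simpa using hmv) (by simpa [hlev] using hF.map_fst)
    refine ⟨X', by simpa [undoProg, hmv, h.env.reg_delta, h.env.reg_one, hleft, hright] using hh,
      ?_⟩
    simpa [hX', hlev] using completes_node_iff.2 ⟨ha, hb, hab, by simpa [hX, hlev] using hF⟩

theorem Valid.addr_add_le_tableEnd (h : s.Valid n K) : addr n K s + 8 ≤ tableEnd n K := by
  have := h.index_lt
  unfold addr tableEnd cell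
  omega

/-- Load the level of the record at `rAddr`, and the step that has led to it. -/
def loadMove : Prog :=
  .block [.add rPtr rAddr rOne, .load rLev rPtr, .const rPtr 5, .add rPtr rAddr rPtr,
    .load rMove rPtr]

/-- Go to the record of the previous configuration. -/
def loadParent : Prog :=
  .block [.const rPtr 4, .add rPtr rAddr rPtr, .load rAddr rPtr]

/-- Undo the step that has led to the record at `rAddr`. -/
def backProg : Prog :=
  .block [loadMove, undoProg, loadParent]

/-- The machine has `j` records left to go back through, and the trees it has built complete the
configuration of the next one. -/
def Unwound (n K : ℕ) (d : List ℕ) (m : ℕ → ℕ) : ℕ → State → Prop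
  | 0, σ => σ.reg rAddr = 0 ∧ ∃ X, Holds n K m [] X σ ∧ Completes K d start (forest X)
  | j + 1, σ => ∃ s X, Chain n K d m j s ∧ σ.reg rAddr = addr n K s ∧ Holds n K m [] X σ ∧
      Completes K d s (forest X)

theorem Holds.run_backProg {p : ℕ} (h : Holds n K m Y X σ) (hr : IsRecord n K m s p mv)
    (haddr : σ.reg rAddr = addr n K s)
    (hundo : ∀ τ, Holds n K m Y X τ → τ.reg rMove = mv → τ.reg rLev = s.lev →
      ∃ X', Holds n K m Y X' (undoProg.run τ) ∧ Completes K D s' (forest X')) :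
    (backProg.run σ).reg rAddr = p ∧
      ∃ X', Holds n K m Y X' (backProg.run σ) ∧ Completes K D s' (forest X') := by
  have hle := hr.valid.addr_add_le_tableEnd
  obtain ⟨X', h', hF⟩ := hundo (loadMove.run σ) (h.run rfl rfl (by decide))
    (by simp [loadMove, haddr, h.mem _ (show addr n K s + 5 < _ by omega), hr.move])
    (by simp [loadMove, haddr, h.env.reg_one, h.mem _ (show addr n K s + 1 < _ by omega), hr.lev])
  have haddr' : (undoProg.run (loadMove.run σ)).reg rAddr = addr n K s := by
    rw [Prog.reg_run_of_notMem_targets rfl (by decide)]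
    simp [loadMove, haddr]
  refine ⟨?_, X', h'.run (P := loadParent) rfl rfl (by decide), hF⟩
  simp [backProg, loadParent, haddr', h'.mem _ (show addr n K s + 4 < _ by omega), hr.parent]

theorem Unwound.run_backProg (h : Unwound n K d m (j + 1) σ) :
    Unwound n K d m j (backProg.run σ) := by
  obtain ⟨s, X, hc, haddr, hh, hF⟩ := h
  cases hc with
  | start hr =>
    exact hh.run_backProg hr haddr fun τ hτ hmv _ => ⟨X, by simpa [undoProg, hmv] using hτ, hF⟩
  | step hc hs hr =>
    obtain ⟨haddr', X', hh', hF'⟩ := hh.run_backProg hr haddr fun τ hτ hmv hlev =>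
      hτ.run_undoProg hs hr.valid hmv hlev hF
    exact ⟨_, X', hc, haddr', hh', hF'⟩

/-- Return the tree at level `0`. -/
def outputProg : Prog :=
  .block [.const rSlot 0, popProg, .copy rK rNode, .const rN 1]

theorem Unwound.run_outputProg (h : Unwound n K d m 0 σ) :
    (outputProg.run σ).reg rN = 1 ∧ ∃ T S, T.IsL (K + 1) ∧ T.Meets d ∧
      Stored (outputProg.run σ).mem T ((outputProg.run σ).reg rK) S := by
  obtain ⟨-, X, hX, hF⟩ := h
  obtain ⟨T, hT⟩ := hF.exists_eq_singleton
  have hpos : 0 < tableEnd n K := by simp [tableEnd, cell, tableSize]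
  obtain ⟨e, X', -, hX', hroot, hh⟩ := (hX.run (P := .const rSlot 0) rfl rfl
    (by decide)).run_popProg (by simpa using hpos) (by simp [hT])
  rw [hT, forest_cons, Multiset.singleton_eq_cons_iff, Prod.mk.injEq] at hX'
  obtain ⟨⟨-, htree⟩, -⟩ := hX'
  obtain ⟨hL, hM⟩ := completes_start_iff.1 (hT ▸ hF)
  refine ⟨by simp [outputProg], T, e.cells, hL, hM, ?_⟩
  have hs := hh.heap.packed.stored e (by simp)
  rw [← hroot, ← htree] at hs
  simpa [outputProg] using hs

/-- Build the tree described by the table. -/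
def buildProg : Prog :=
  .seq (.block [.copy rAddr rGoal, .add rFree rEnd rEnd]) (.seq (.loop rAddr backProg) outputProg)

theorem Swept.haltsWithin_buildProg (h : Swept n K d 0 σ) (hgoal : σ.reg rGoal ≠ 0)
    (hd : d.length = n) : HaltsWithin buildProg σ (tableSize n K * 59 + 15) fun τ =>
      τ.reg rN = 1 ∧ ∃ T S, T.IsL (K + 1) ∧ T.Meets d ∧ Stored τ.mem T (τ.reg rK) S := by
  obtain ⟨j, s, hc, hdone, haddr⟩ := h.exists_goal hgoal
  have hinit : Unwound n K d σ.mem (j + 1)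
      ((Prog.block [.copy rAddr rGoal, .add rFree rEnd rEnd]).run σ) := by
    have hpend : s.pend = 0 := by
      have := hc.valid.card_le
      exact Multiset.card_eq_zero.1 (by omega)
    refine ⟨s, [], hc, by simpa using haddr, ⟨h.env.run rfl (by decide), by simp, ?_⟩, ?_⟩
    · simpa [h.env.reg_end, two_mul] using Heap.nil (tableEnd n K) σ.mem
    · obtain ⟨l, i, M⟩ := s
      obtain rfl : i = n := hdone
      obtain rfl : M = 0 := hpend
      exact completes_zero (by simpa using hd) l
  have hj : j + 1 ≤ tableSize n K := by
    have := hc.valid.card_pos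
    have := hc.valid.card_le
    have := hc.index_add_le
    have := (valid_start (n := n) (K := K) (by omega)).index_lt
    omega
  refine ((HaltsWithin.of_loopFree (Q := Unwound n K d σ.mem (j + 1)) rfl hinit).seq
    fun τ hτ => (HaltsWithin.loop (I := Unwound n K d σ.mem) (T := backProg.cost) (fun _ h => h.1)
      (fun i ρ hρ => ⟨?_, .of_loopFree rfl hρ.run_backProg⟩) (j + 1) τ hτ).seq fun ρ hρ =>
        .of_loopFree rfl hρ.run_outputProg).of_le ?_
  · obtain ⟨s, X, hc, haddr, -⟩ := hρ
    exact haddr.trans_ne (addr_ne_zero hc.valid)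
  · have hback : backProg.cost = 58 := by decide
    have hout : outputProg.cost = 11 := by decide
    have := Nat.mul_le_mul_right 59 hj
    simp only [Prog.cost, Prog.block, hback, hout]
    omega

/-! ### The algorithm -/

/-- The first `e` powers of the base have been appended to the input. -/
structure Powers (n K : ℕ) (d : List ℕ) (e : ℕ) (σ : State) : Prop where
  reg_n : σ.reg rN = n
  reg_one : σ.reg rOne = 1
  reg_delta : σ.reg rDelta = K
  reg_base : σ.reg rBase = n + 1
  reg_pow : σ.reg rPow = 8 * (n + 1) ^ e
  reg_table : σ.reg rTable = n + e
  reg_eight : σ.reg rEight = 8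
  input : ∀ q < n, σ.mem q = d.getD q 0
  pow : ∀ i < e, σ.mem (n + i) = 8 * (n + 1) ^ i
  zero : ∀ q, n + e ≤ q → σ.mem q = 0

/-- Set up the constants. -/
def initProg : Prog :=
  .block [.const rOne 1, .sub rDelta rK rOne, .add rBase rN rOne, .const rPow 8, .const rEight 8,
    .copy rTable rN, .copy rIter rDelta]

theorem powers_run_initProg (k : ℕ) (d : List ℕ) :
    Powers d.length (k - 1) d 0 (initProg.run (input k d)) := by
  constructor <;> simp +contextual [initProg, input]

/-- Store the current power of the base, and compute the next one. -/
def powBody : Prog :=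
  .seq (.block [.store rTable rPow, .add rTable rTable rOne, .copy rTmp rPow])
    (.seq (.mul rPow rTmp rBase rCount) (.sub rIter rIter rOne))

theorem Powers.haltsWithin_powBody {e : ℕ} (h : Powers n K d e σ) :
    HaltsWithin powBody σ (3 * n + 11) fun τ =>
      Powers n K d (e + 1) τ ∧ τ.reg rIter = σ.reg rIter - 1 := by
  refine ((HaltsWithin.of_loopFree (Q := (· = (Prog.block _).run σ)) rfl rfl).seq
    (T' := 3 * (n + 1) + 4) ?_).of_le (by simp only [Prog.cost, Prog.block]; omega)
  rintro _ rfl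
  refine ((haltsWithin_mul (a := 8 * (n + 1) ^ e) (b := n + 1) (by simp [h.reg_one])
    (by simp [h.reg_pow]) (by simp [h.reg_base]) (by decide)).and_reg_eq.and_mem_eq rfl).seq
      fun τ hτ => .of_loopFree (P := .sub rIter rIter rOne) rfl ?_
  obtain ⟨⟨hmul, hreg⟩, hmem⟩ := hτ
  have hpow' : ∀ i < e + 1, Function.update σ.mem (n + e) (8 * (n + 1) ^ e) (n + i) =
      8 * (n + 1) ^ i := by
    intro i hi
    rcases eq_or_ne i e with rfl | hne
    · simp
    · rw [Function.update_of_ne (by omega), h.pow i (by omega)]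
  have hmem' : τ.mem = Function.update σ.mem (n + e) (8 * (n + 1) ^ e) := by
    simp [hmem, h.reg_table, h.reg_pow]
  simp only [Prog.mul, Prog.targets, Prog.block] at hreg
  refine ⟨?_, by simp [hreg, h.reg_one]⟩
  constructor
  case input =>
    intro q hq
    simp [hmem', Function.update_of_ne (show q ≠ n + e by omega), h.input q hq]
  case pow => simpa [hmem'] using hpow'
  case zero =>
    intro q hq
    simp [hmem', Function.update_of_ne (show q ≠ n + e by omega), h.zero q (by omega)]
  all_goals simp [hreg, hmul, h.reg_n, h.reg_one, h.reg_delta, h.reg_base, h.reg_pow, h.reg_table,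
    h.reg_eight, pow_succ, mul_assoc, add_assoc]

/-- Store the powers of the base. -/
def powProg : Prog := .seq initProg (.loop rIter powBody)

theorem haltsWithin_powProg (k : ℕ) (d : List ℕ) :
    HaltsWithin powProg (input k d) ((k - 1) * (3 * d.length + 12) + 9)
      (Powers d.length (k - 1) d (k - 1)) := by
  refine ((HaltsWithin.of_loopFree (Q := (· = initProg.run (input k d))) rfl rfl).seq
    (T' := (k - 1) * (3 * d.length + 12) + 1) ?_).of_le
      (by simp only [initProg, Prog.cost, Prog.block]; omega)
  rintro _ rfl
  refine (HaltsWithin.loop (I := fun j σ => σ.reg rIter = j ∧ ∃ e, e + j = k - 1 ∧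
    Powers d.length (k - 1) d e σ) (fun _ h => h.1) ?_ _ _ ⟨?_, 0, zero_add _,
      powers_run_initProg k d⟩).imp ?_
  · rintro j σ ⟨hj, e, he, h⟩
    exact ⟨by omega, h.haltsWithin_powBody.imp fun τ ⟨h', hτ⟩ =>
      ⟨hτ.trans (by omega), e + 1, by omega, h'⟩⟩
  · simp [initProg, input]
  · rintro σ ⟨-, e, rfl, h⟩
    exact h

/-- Compute the size of the table. -/
def sizeProg : Prog :=
  .seq (.mul rRow rPow rBase rCount) (.seq (.mul rLayer rRow rBase rCount)
    (.seq (.mul rAcc rDelta rN rCount) (.seq (.add rAcc rAcc rOne)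
      (.mul rSweep rLayer rAcc rCount))))

theorem Powers.haltsWithin_sizeProg (h : Powers n K d K σ) :
    HaltsWithin sizeProg σ (9 * n + 3 * (K * n) + 22) fun τ => Powers n K d K τ ∧
      τ.reg rRow = 8 * (n + 1) ^ (K + 1) ∧ τ.reg rLayer = 8 * (n + 1) ^ (K + 2) ∧
      τ.reg rSweep = 8 * tableSize n K := by
  suffices HaltsWithin sizeProg σ (9 * n + 3 * (K * n) + 22) fun τ =>
      τ.reg rRow = 8 * (n + 1) ^ (K + 1) ∧ τ.reg rLayer = 8 * (n + 1) ^ (K + 2) ∧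
      τ.reg rSweep = 8 * tableSize n K by
    refine (this.and_reg_eq.and_mem_eq rfl).imp fun τ ⟨⟨hτ, hreg⟩, hmem⟩ => ⟨?_, hτ⟩
    have hreg' : ∀ x ∈ [rN, rOne, rDelta, rBase, rPow, rTable, rEight], τ.reg x = σ.reg x :=
      fun x hx => hreg x (by revert x; decide)
    simp only [List.forall_mem_cons] at hreg'
    obtain ⟨h₁, h₂, h₃, h₄, h₅, h₆, h₇, -⟩ := hreg'
    exact ⟨h₁ ▸ h.reg_n, h₂ ▸ h.reg_one, h₃ ▸ h.reg_delta, h₄ ▸ h.reg_base, h₅ ▸ h.reg_pow,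
      h₆ ▸ h.reg_table, h₇ ▸ h.reg_eight, hmem ▸ h.input, hmem ▸ h.pow, hmem ▸ h.zero⟩
  refine (((haltsWithin_mul (x := rRow) (w := rCount) h.reg_one h.reg_pow h.reg_base
    (by decide)).and_reg_eq.seq fun τ ⟨hrow, hτ⟩ => ?_)).of_le (T := 3 * (n + 1) + 3 +
      (3 * (n + 1) + 3 + (3 * n + 3 + (1 + (3 * (K * n + 1) + 3))))) (by omega)
  simp only [Prog.mul, Prog.targets] at hτ
  refine (haltsWithin_mul (x := rLayer) (w := rCount) (by simp [hτ, h.reg_one]) hrow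
    (by simp [hτ, h.reg_base]) (by decide)).and_reg_eq.seq fun υ ⟨hlayer, hυ⟩ => ?_
  simp only [Prog.mul, Prog.targets] at hυ
  refine (haltsWithin_mul (x := rAcc) (w := rCount) (a := K) (by simp [hυ, hτ, h.reg_one])
    (by simp [hυ, hτ, h.reg_delta]) (by simp [hυ, hτ, h.reg_n]) (by decide)).and_reg_eq.seq
      fun ρ ⟨hacc, hρ⟩ => ?_
  simp only [Prog.mul, Prog.targets] at hρ
  refine (HaltsWithin.of_loopFree (Q := (· = (Prog.add rAcc rAcc rOne).run ρ)) rfl rfl).seq ?_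
  rintro _ rfl
  refine (haltsWithin_mul (x := rSweep) (w := rCount) (a := 8 * (n + 1) ^ (K + 2))
    (by simp [hρ, hυ, hτ, h.reg_one]) (by simp [hρ, hlayer, pow_succ, mul_assoc])
      (by simp [hρ, hυ, hτ, hacc, h.reg_one]) (by decide)).and_reg_eq.imp fun π ⟨hsweep, hπ⟩ => ?_
  simp only [Prog.mul, Prog.targets] at hπ
  refine ⟨?_, ?_, hsweep.trans ?_⟩
  · simp [hπ, hρ, hυ, hrow, pow_succ, mul_assoc]
  · simp [hπ, hρ, hlayer, pow_succ, mul_assoc]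
  · rw [tableSize]
    ring

/-- Initialize the sweep, and describe the record of the start configuration. -/
def startRecord : Prog :=
  .block [.add rEnd rTable rSweep, .sub rNewAddr rEnd rRow, .add rNewAddr rNewAddr rPow,
    .const rNewCount 1, .const rNewLev 0, .const rNewDone 0, .copy rNewCode rPow, .const rNewMove 0,
    .const rAddr 0, .const rGoal 0]

/-- Initialize the sweep and the table. -/
def startProg : Prog := .seq startRecord markProg

theorem addr_start :
    addr n K start = tableEnd n K - 8 * (n + 1) ^ (K + 1) + 8 * (n + 1) ^ K := by
  have : (n + 1) ^ (K + 1) ≤ tableSize n K := Nat.le_mul_of_pos_right _ (by positivity)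
  have := index_start (n := n) (K := K)
  unfold addr tableEnd cell
  omega

theorem Powers.run_startProg (h : Powers n K d K σ) (hn : 0 < n)
    (hrow : σ.reg rRow = 8 * (n + 1) ^ (K + 1)) (hlayer : σ.reg rLayer = 8 * (n + 1) ^ (K + 2))
    (hsweep : σ.reg rSweep = 8 * tableSize n K) :
    Env n K (startProg.run σ).reg ∧ Table n K d (startProg.run σ).mem ∧
      (startProg.run σ).reg rSweep = 8 * tableSize n K ∧ (startProg.run σ).reg rGoal = 0 := by
  have hend : (startRecord.run σ).reg rEnd = tableEnd n K := by
    simp [startRecord, h.reg_table, hsweep, tableEnd, cell]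
  have hrecord : HoldsRecord n K start 0 (startRecord.run σ) := by
    constructor
    case reg_addr =>
      rw [addr_start]
      simp [startRecord, h.reg_table, hsweep, hrow, h.reg_pow, tableEnd, cell]
    all_goals simp [startRecord, start, levelCode, h.reg_pow]
  obtain ⟨hr, hm⟩ := hrecord.run_markProg (by simp [startRecord, h.reg_one]) (valid_start hn)
    (h.zero _ (by unfold addr cell; omega))
  have hreg : ∀ x ∉ markProg.targets, (startProg.run σ).reg x = (startRecord.run σ).reg x :=
    fun x hx => Prog.reg_run_of_notMem_targets rfl hx _
  refine ⟨?_, table_start h.input h.pow h.zero hm hr, ?_, ?_⟩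
  · constructor <;> rw [hreg _ (by decide)]
    case reg_end => exact hend
    all_goals simp [startRecord, h.reg_n, h.reg_one, h.reg_delta, h.reg_base, h.reg_pow, hrow,
      hlayer, h.reg_table, h.reg_eight]
  · rw [hreg _ (by decide)]
    simp [startRecord, hsweep]
  · rw [hreg _ (by decide)]
    simp [startRecord]

/-- Decide whether the input is realizable, and build a tree if it is. -/
def searchProg : Prog :=
  .seq powProg (.seq sizeProg (.seq startProg (.seq sweepProg
    (.branch rGoal buildProg (.const rN 0)))))

/-- The state contains a correct answer for `k` and the list `d`. -/
def Answers (k : ℕ) (d : List ℕ) (σ : State) : Prop :=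
  (Realizable k d → σ.reg 0 = 1 ∧
    ∃ T S, T.IsL k ∧ T.Meets d ∧ Stored σ.mem T (σ.reg 1) S) ∧
  (¬ Realizable k d → σ.reg 0 = 0)

theorem Swept.haltsWithin_answer {k : ℕ} (h : Swept d.length (k - 1) d 0 σ) (hd : d ≠ []) :
    HaltsWithin (.branch rGoal buildProg (.const rN 0)) σ
      (tableSize d.length (k - 1) * 59 + 16) (Answers k d) := by
  refine (HaltsWithin.branch (fun hgoal => ?_) fun hgoal => ?_).of_le (add_comm _ _).le
  · refine (h.haltsWithin_buildProg hgoal rfl).imp fun τ ⟨hone, T, S, hL, hT⟩ => ?_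
    rw [LTree.isL_pred_add_one] at hL
    exact ⟨fun _ => ⟨hone, T, S, hL, hT⟩, fun hD => absurd ⟨T, hL, hT.1⟩ hD⟩
  · refine (HaltsWithin.of_loopFree rfl ⟨fun hD => ?_, fun _ => by simp⟩).of_le
      (by simp [Prog.cost])
    obtain ⟨s, hs, hdone⟩ := (realizable_pred_add_one.2 hD).exists_reachable
      (Multiset.coe_card d) (List.length_pos_iff.2 hd)
    exact absurd hgoal (h.goal_ne_zero_of_reachable (List.length_pos_iff.2 hd) hs hdone)

theorem searchProg_time_le (n K : ℕ) :
    K * (3 * n + 12) + 9 + (9 * n + 3 * (K * n) + 22 + (startProg.cost +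
      (tableSize n K * (7 * n + 32 * K + 53) + 1 + (tableSize n K * 59 + 16)))) ≤
        200 * ((K + 1) * (tableSize n K * (n + 1))) := by
  have hcost : startProg.cost ≤ 40 := by decide
  have hpos : 1 ≤ tableSize n K := by
    unfold tableSize
    exact Nat.succ_le_of_lt (by positivity)
  calc
    _ ≤ tableSize n K * (7 * n + 32 * K + 112) + (6 * (K * n) + 12 * K + 9 * n + 88) := by
      linarith
    _ ≤ tableSize n K * (112 * ((K + 1) * (n + 1))) +
        tableSize n K * (88 * ((K + 1) * (n + 1))) := by
      refine add_le_add (Nat.mul_le_mul_left _ (by linarith [(K * n).zero_le])) ?_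
      exact (Nat.le_mul_of_pos_left _ hpos).trans' (by linarith [(K * n).zero_le])
    _ = _ := by ring

theorem tableSize_mul_le {n : ℕ} (k : ℕ) (hn : 0 < n) :
    tableSize n (k - 1) * (n + 1) ≤ 2 ^ (k + 3) * (k + 1) * n ^ (k + 3) := by
  have hbase : n + 1 ≤ 2 * n := by omega
  cases k with
  | zero =>
    calc
      _ = (n + 1) ^ 3 := by
        simp [tableSize]
        ring
      _ ≤ (2 * n) ^ 3 := Nat.pow_le_pow_left hbase 3
      _ = _ := by ring
  | succ K =>
    calc
      _ = (n + 1) ^ (K + 3) * (K * n + 1) := by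
        simp [tableSize]
        ring
      _ ≤ (2 * n) ^ (K + 3) * (2 * (K + 2) * n) :=
        Nat.mul_le_mul (Nat.pow_le_pow_left hbase _) (by nlinarith)
      _ = _ := by ring

theorem haltsWithin_searchProg (k : ℕ) (hd : d ≠ []) :
    HaltsWithin searchProg (input k d)
      (200 * ((k - 1 + 1) * (tableSize d.length (k - 1) * (d.length + 1)))) (Answers k d) := by
  refine ((haltsWithin_powProg k d).seq fun σ h => h.haltsWithin_sizeProg.seq
    fun τ ⟨h, hrow, hlayer, hsweep⟩ => (HaltsWithin.of_loopFree (Q := (· = startProg.run τ))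
      rfl rfl).seq (fun υ hυ => ?_)).of_le (searchProg_time_le _ _)
  obtain ⟨henv, htable, hsweep, hgoal⟩ :=
    h.run_startProg (List.length_pos_iff.2 hd) hrow hlayer hsweep
  exact hυ ▸ (haltsWithin_sweepProg henv htable hsweep hgoal rfl).seq
    fun ρ hρ => hρ.haltsWithin_answer hd

end Conf

theorem mainTheorem1 :
    ∃ P : RAM.Prog, ∀ k : ℕ, ∃ C : ℕ, ∀ d : List ℕ, d ≠ [] →
      ∃ (t : ℕ) (s : RAM.State), RAM.Exec P (RAM.input k d) t s ∧
        t ≤ C * d.length ^ (k + 3) ∧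
        (Realizable k (d : Multiset ℕ) → s.reg 0 = 1 ∧
          ∃ (T : LTree) (S : Finset ℕ),
            T.IsL k ∧ T.Meets (d : Multiset ℕ) ∧ RAM.Stored s.mem T (s.reg 1) S) ∧
        (¬ Realizable k (d : Multiset ℕ) → s.reg 0 = 0) := by
  refine ⟨Conf.searchProg, fun k => ⟨200 * (k - 1 + 1) * (2 ^ (k + 3) * (k + 1)), fun d hd => ?_⟩⟩
  obtain ⟨t, s, hexec, ht, hs⟩ := Conf.haltsWithin_searchProg k hd
  refine ⟨t, s, hexec, ht.trans ?_, hs⟩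
  have hle := Conf.tableSize_mul_le k (List.length_pos_iff.2 hd)
  calc
    _ = 200 * (k - 1 + 1) * (Conf.tableSize d.length (k - 1) * (d.length + 1)) := by ring
    _ ≤ 200 * (k - 1 + 1) * (2 ^ (k + 3) * (k + 1) * d.length ^ (k + 3)) :=
      Nat.mul_le_mul_left _ hle
    _ = _ := by ring
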